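/- Let $\lambda>1$ and $1<s<2$, and let $$W_\lambda(t)=\sum_{k=1}^{\infty}\lambda^{(s-2)k}\sin(\lambda^k t),\qquad t\in\mathbb R .$$ For $0<q<1$, $y\in\mathbb R$ and a function $g$, let the Riemann–Liouville derivative of order $q$ with base point $y$ be $$\frac{d^q g(x)}{[d(x-y)]^q}=\frac1{\Gamma(1-q)}\,\frac{d}{dx}\int_y^x\frac{g(u)}{|x-u|^{q}}\,du\qquad(x\ne y),$$ whenever the integral converges near $x$ and is differentiable at $x$. (For $x>y$ this is the usual Riemann–Liouville derivative; for $x<y$ it is the right-sided one.) The local fractional derivative of order $q$ of $f:\mathbb R\to\mathbb R$ at $y$ is $$I\!\!D^q f(y)=\lim_{x\to y}\frac{d^q\,(f(x)-f(y))}{[d(x-y)]^q};$$ it exists if the Riemann–Liouville derivative exists at all $x\neq y$ close to $y$ and the limit exists and is finite. The local fractional derivatives from the right and from the left are defined in the same way, with $x$ restricted to $x>y$ and to $x<y$. The critical order of $f$ at $y$ is the supremum of all $q\in[0,1]$ such that all local fractional derivatives of $f$ at $y$ of orders in $(0,q)$ exist. Then at every point $\tau\in\mathbb R$, and for each of the three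 versions (two-sided, from the right, from the left) of the local fractional derivative: 1. $I\!\!D^qW_\lambda(\tau)$ exists and equals $0$ for every $0<q<2-s$; 2. $I\!\!D^qW_\lambda(\tau)$ does not exist for any $q$ with $2-s<q<1$; 3. the critical order of $W_\lambda$ at $\tau$ is $2-s$. Moreover $s$ is the box dimension of the graph of $W_\lambda$ over every interval $[a,b]$, $a<b$. That is, if $N(\varepsilon)$ is the least number of closed squares of half-side $\varepsilon$, with sides parallel to the axes and centred on this graph, that cover it, then $\log N(\varepsilon)/(-\log\varepsilon)\to s$ as $\varepsilon\to0^+$. -/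

import Mathlib

open Filter Topology Set

noncomputable section

/-- The Weierstrass function `W_λ(t) = ∑_{k ≥ 1} λ^{(s-2)k} sin(λ^k t)`
(the summation index is shifted, `k = j + 1`). -/
def weierstrass (lam s t : ℝ) : ℝ :=
  ∑' j : ℕ, lam ^ ((s - 2) * ((j : ℝ) + 1)) * Real.sin (lam ^ (j + 1) * t)

/-- For `λ > 1` and `s < 2` the series of the Weierstrass function converges absolutely. -/
theorem weierstrass_summable {lam s : ℝ} (hlam : 1 < lam) (hs : s < 2) (t : ℝ) :
    Summable fun j : ℕ =>
      |lam ^ ((s - 2) * ((j : ℝ) + 1)) * Real.sin (lam ^ (j + 1) * t)| := by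
  have h0 : 0 < lam := by linarith
  have hr : lam ^ (s - 2) < 1 := Real.rpow_lt_one_of_one_lt_of_neg hlam (by linarith)
  have hg : Summable fun j : ℕ => (lam ^ (s - 2)) ^ (j + 1) :=
    (summable_nat_add_iff 1).2
      (summable_geometric_of_lt_one (Real.rpow_nonneg h0.le _) hr)
  refine Summable.of_nonneg_of_le (fun _ => abs_nonneg _) (fun j => ?_) hg
  have he : lam ^ ((s - 2) * ((j : ℝ) + 1)) = (lam ^ (s - 2)) ^ (j + 1) := by
    rw [Real.rpow_mul h0.le, ← Real.rpow_natCast]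
    push_cast
    rfl
  rw [abs_mul, he, abs_of_nonneg (pow_nonneg (Real.rpow_nonneg h0.le _) _)]
  exact mul_le_of_le_one_right (pow_nonneg (Real.rpow_nonneg h0.le _) _) (Real.abs_sin_le_one _)

/-- The Riemann-Liouville integral `(1 / Γ(1 - q)) ∫_a^x g(u) |x - u|^{-q} du` of order `1 - q`
with lower limit `a`, for `0 < q < 1`. -/
def rlIntegral (q a : ℝ) (g : ℝ → ℝ) (x : ℝ) : ℝ :=
  (1 / Real.Gamma (1 - q)) * ∫ u in a..x, g u / |x - u| ^ q

/-- `g` has at `x` the Riemann-Liouville derivative `d^q g(x) / [d(x - a)]^q = D` of order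
`0 < q < 1` with base point `a`: near `x` the Riemann-Liouville integral converges, and it is
differentiable at `x` with derivative `D`. For `x > a` this is
`(1 / Γ(1 - q)) (d/dx) ∫_a^x g(u) (x - u)^{-q} du`, and for `x < a` it is the right-sided
derivative `-(1 / Γ(1 - q)) (d/dx) ∫_x^a g(u) (u - x)^{-q} du`. -/
def HasRLDerivAt (q a : ℝ) (g : ℝ → ℝ) (D x : ℝ) : Prop :=
  (∀ᶠ x' in 𝓝 x, IntervalIntegrable (fun u => g u / |x' - u| ^ q) MeasureTheory.volume a x') ∧
    HasDerivAt (rlIntegral q a g) D x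

/-- `f` has at `y` the local fractional derivative `L` of order `q` along `S`: the derivative
`d^q (f(x) - f(y)) / [d(x - y)]^q` exists for all `x ≠ y` in `S` close to `y`, and it tends to `L`
as `x → y` in `S`. `S = univ` is the two-sided notion, `S = Ici y` and `S = Iic y` are the
one-sided ones. -/
def HasLFDWithin (q : ℝ) (f : ℝ → ℝ) (S : Set ℝ) (L y : ℝ) : Prop :=
  ∃ D : ℝ → ℝ,
    (∀ᶠ x in 𝓝[S \ {y}] y, HasRLDerivAt q y (fun u => f u - f y) (D x) x) ∧
      Tendsto D (𝓝[S \ {y}] y) (𝓝 L)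

/-- The local fractional derivative of order `q` of `f` at `y` along `S` exists and is finite. -/
def LFDExistsWithin (q : ℝ) (f : ℝ → ℝ) (S : Set ℝ) (y : ℝ) : Prop :=
  ∃ L : ℝ, HasLFDWithin q f S L y

/-- The critical order of `f` at `y` along `S`: the supremum of all `q` such that all local
fractional derivatives of order less than `q` exist at `y`. Orders range over `(0, 1)`, so this is
the supremum of a subset of `[0, 1]` that contains `0`. -/
def criticalOrderWithin (f : ℝ → ℝ) (S : Set ℝ) (y : ℝ) : ℝ :=
  sSup {q : ℝ | q ∈ Icc (0 : ℝ) 1 ∧ ∀ p ∈ Ioo 0 q, LFDExistsWithin p f S y}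

/-- The nonempty set `A` has box dimension `d`: all its covering numbers `N(ε)` by closed balls of
radius `ε > 0` are finite, and `log N(ε) / (-log ε) → d` as `ε → 0+`. -/
def HasBoxDim {X : Type*} [PseudoEMetricSpace X] (A : Set X) (d : ℝ) : Prop :=
  A.Nonempty ∧ (∀ ε : NNReal, 0 < ε → Metric.coveringNumber ε A ≠ ⊤) ∧
    Tendsto (fun ε : NNReal => Real.log ((Metric.coveringNumber ε A).toNat : ℝ) / -Real.log ε)
      (𝓝[>] 0) (𝓝 d)

end

/-! Put α = 2 - s and r = λ^(-α). Then W is the lacunary series ∑ r^k sin(λ^k t) with r < 1 < rλ,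
and its oscillation over every interval of small length h is of exact order h^α. The upper bound
(`exists_abs_lacunary_sub_le`) comes from cutting the series where λ^k is about 1/h. For the lower
bound (`exists_lacunary_osc`), increments of W around a point are integrated against a rapidly
decreasing function with spectrum near one frequency. At scale λ^(-k) this isolates the k-th term,
and the result has modulus r^k / 2 at every point, so W cannot be flat anywhere at that scale.

Existence for q < α (`hasLFDWithin_lacunary_Ici`): the Riemann-Liouville derivative of sin(ωu) -
sin(ωτ) is O(ω^q) uniformly in x, so the differentiated series is dominated by ∑ (rλ^q)^k, which
converges because q < α. Each term tends to 0 as x → τ, hence so does the sum.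

Non-existence for q > α: a finite limit makes the Riemann-Liouville integral F of f - f(τ) Lipschitz
to the right of τ. Abel inversion recovers f - f(τ), up to a constant, as the derivative of a
fractional integral of F, which gives |f(x) - f(τ)| = O((x - τ)^q)
(`exists_abs_sub_le_of_LFDExistsWithin_Ici`). This contradicts oscillation of order h^α on [τ, τ +
h]. The left-sided statements follow because W is odd.

Box dimension (`hasBoxDim_graph`): there are about 1/ε columns of width ε, and each needs about ε^α
/ ε squares, hence ε^(-(2 - α)) in all. -/

open MeasureTheory

/-! ### The lacunary series: convergence and Hölder bound. -/

/-- The lacunary sine series `∑_{k ≥ 1} r^k sin(L^k t)`. -/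
noncomputable def lacunary (r L t : ℝ) : ℝ := ∑' j : ℕ, r ^ (j + 1) * Real.sin (L ^ (j + 1) * t)

theorem weierstrass_eq_lacunary {lam : ℝ} (s : ℝ) (hlam : 0 < lam) :
    weierstrass lam s = lacunary (lam ^ (s - 2)) lam := by
  funext t
  unfold weierstrass lacunary
  refine tsum_congr fun j => ?_
  congr 1
  rw [Real.rpow_mul hlam.le, ← Real.rpow_natCast]
  push_cast
  rfl

theorem summable_pow_succ {r : ℝ} (hr0 : 0 ≤ r) (hr1 : r < 1) : Summable fun j : ℕ => r ^ (j + 1) :=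
  (summable_nat_add_iff 1).2 (summable_geometric_of_lt_one hr0 hr1)

theorem norm_lacunary_term_le {r : ℝ} (hr0 : 0 ≤ r) (L t : ℝ) (j : ℕ) :
    ‖r ^ (j + 1) * Real.sin (L ^ (j + 1) * t)‖ ≤ r ^ (j + 1) := by
  rw [norm_mul, Real.norm_of_nonneg (pow_nonneg hr0 _)]
  exact mul_le_of_le_one_right (pow_nonneg hr0 _) (Real.abs_sin_le_one _)

theorem summable_lacunary {r : ℝ} (hr0 : 0 ≤ r) (hr1 : r < 1) (L t : ℝ) :
    Summable fun j : ℕ => r ^ (j + 1) * Real.sin (L ^ (j + 1) * t) :=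
  .of_norm_bounded (summable_pow_succ hr0 hr1) (norm_lacunary_term_le hr0 L t)

theorem continuous_lacunary {r : ℝ} (hr0 : 0 ≤ r) (hr1 : r < 1) (L : ℝ) :
    Continuous (lacunary r L) :=
  continuous_tsum (fun _ => by fun_prop) (summable_pow_succ hr0 hr1)
    fun j t => norm_lacunary_term_le hr0 L t j

theorem lacunary_neg (r L t : ℝ) : lacunary r L (-t) = -lacunary r L t := by
  simp [lacunary, tsum_neg]

theorem abs_sin_sub_sin_le (a b : ℝ) : |Real.sin a - Real.sin b| ≤ |a - b| := by
  rw [Real.sin_sub_sin, abs_mul, abs_mul, abs_two]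
  have h1 : |Real.sin ((a - b) / 2)| ≤ |a - b| / 2 := by
    simpa [abs_div] using Real.abs_sin_le_abs (x := (a - b) / 2)
  nlinarith [Real.abs_cos_le_one ((a + b) / 2), abs_nonneg (Real.sin ((a - b) / 2)),
    abs_nonneg (Real.cos ((a + b) / 2))]

/-- The first k terms are Lipschitz, and their constants form a geometric sum of ratio r L > 1,
controlled by its last term; the remaining terms are bounded trivially. No relation between k and v
is imposed: with L^k |v| ≤ 1 this is the Hölder bound, and with L^k |v| large it is a linear growth
bound. -/
theorem abs_lacunary_sub_le {r L : ℝ} (hr0 : 0 < r) (hr1 : r < 1) (hL : 0 < L) (hrL : 1 < r * L)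
    (k : ℕ) (t v : ℝ) :
    |lacunary r L (t + v) - lacunary r L t| ≤
      r ^ k * (r * L / (r * L - 1) * (L ^ k * |v|) + 2 * r / (1 - r)) := by
  have hs := (summable_lacunary hr0.le hr1 L (t + v)).sub (summable_lacunary hr0.le hr1 L t)
  have hhead : |∑ j ∈ Finset.range k, (r ^ (j + 1) * Real.sin (L ^ (j + 1) * (t + v)) -
      r ^ (j + 1) * Real.sin (L ^ (j + 1) * t))| ≤
      r ^ k * (r * L / (r * L - 1) * (L ^ k * |v|)) := by
    calc _ ≤ ∑ j ∈ Finset.range k, (r * L) * |v| * (r * L) ^ j := by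
          refine (Finset.abs_sum_le_sum_abs _ _).trans (Finset.sum_le_sum fun j _ => ?_)
          rw [← mul_sub, abs_mul, abs_of_pos (pow_pos hr0 _)]
          have h := abs_sin_sub_sin_le (L ^ (j + 1) * (t + v)) (L ^ (j + 1) * t)
          rw [← mul_sub, add_sub_cancel_left, abs_mul, abs_of_pos (pow_pos hL _)] at h
          calc _ ≤ r ^ (j + 1) * (L ^ (j + 1) * |v|) := by gcongr
            _ = _ := by rw [mul_pow]; ring
      _ = (r * L) * |v| * (((r * L) ^ k - 1) / (r * L - 1)) := by
          rw [← Finset.mul_sum, geom_sum_eq hrL.ne']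
      _ ≤ (r * L) * |v| * ((r * L) ^ k / (r * L - 1)) := by
          have : 0 < r * L - 1 := by linarith
          gcongr
          linarith
      _ = _ := by rw [mul_pow]; ring
  have htail : |∑' j : ℕ, (r ^ (j + k + 1) * Real.sin (L ^ (j + k + 1) * (t + v)) -
      r ^ (j + k + 1) * Real.sin (L ^ (j + k + 1) * t))| ≤ r ^ k * (2 * r / (1 - r)) := by
    have hg : HasSum (fun j : ℕ => 2 * r ^ (k + 1) * r ^ j) (2 * r ^ (k + 1) * (1 - r)⁻¹) :=
      (hasSum_geometric_of_lt_one hr0.le hr1).mul_left _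
    have := tsum_of_norm_bounded hg (f := fun j : ℕ =>
      r ^ (j + k + 1) * Real.sin (L ^ (j + k + 1) * (t + v)) -
      r ^ (j + k + 1) * Real.sin (L ^ (j + k + 1) * t)) fun j => by
        have h1 := norm_lacunary_term_le hr0.le L (t + v) (j + k)
        have h2 := norm_lacunary_term_le hr0.le L t (j + k)
        calc _ ≤ _ := norm_sub_le _ _
          _ ≤ r ^ (j + k + 1) + r ^ (j + k + 1) := add_le_add h1 h2
          _ = _ := by ring
    refine (Real.norm_eq_abs _ ▸ this).trans (le_of_eq ?_)
    rw [pow_succ]; ring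
  unfold lacunary
  rw [← (summable_lacunary hr0.le hr1 L (t + v)).tsum_sub (summable_lacunary hr0.le hr1 L t),
    ← hs.sum_add_tsum_nat_add k, mul_add]
  exact (abs_add_le _ _).trans (add_le_add hhead htail)

/-- At scales at most `1`, the lacunary series is Hölder of exponent `α` if `r = L ^ (-α)`. -/
theorem exists_abs_lacunary_sub_le {r L α : ℝ} (hr1 : r < 1) (hL : 1 < L) (hrL : 1 < r * L)
    (hr : r = L ^ (-α)) (hα : 0 < α) :
    ∃ C : ℝ, 0 < C ∧ ∀ h : ℝ, 0 < h → h ≤ 1 → ∀ t v : ℝ, |v| ≤ h →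
      |lacunary r L (t + v) - lacunary r L t| ≤ C * h ^ α := by
  have hL0 : 0 < L := by linarith
  have hr0 : 0 < r := hr ▸ Real.rpow_pos_of_pos hL0 _
  have hA : 0 < r * L / (r * L - 1) := div_pos (by linarith) (by linarith)
  have hB : 0 < 2 * r / (1 - r) := div_pos (by linarith) (by linarith)
  refine ⟨(r * L / (r * L - 1) + 2 * r / (1 - r)) * L ^ α, by positivity,
    fun h h0 h1 t v hv => ?_⟩
  obtain ⟨k, hk1, hk2⟩ := exists_nat_pow_near ((one_le_inv₀ h0).2 h1) hL
  have hLk : 0 < L ^ k := pow_pos hL0 k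
  -- Here r^k = (L^(-k))^α, and L^(-k) < L h because k is maximal with L^k ≤ 1/h.
  have hrk : r ^ k ≤ L ^ α * h ^ α := by
    rw [← Real.mul_rpow hL0.le h0.le, hr, ← Real.rpow_natCast, ← Real.rpow_mul hL0.le, neg_mul,
      mul_comm α, ← neg_mul, Real.rpow_mul hL0.le, Real.rpow_neg hL0.le, Real.rpow_natCast]
    refine Real.rpow_le_rpow (by positivity) ?_ hα.le
    rw [inv_le_iff_one_le_mul₀ hLk]
    rw [inv_lt_iff_one_lt_mul₀ h0, pow_succ] at hk2
    nlinarith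
  have hLv : L ^ k * |v| ≤ 1 :=
    calc L ^ k * |v| ≤ h⁻¹ * h := by gcongr
      _ = 1 := inv_mul_cancel₀ h0.ne'
  calc _ ≤ _ := abs_lacunary_sub_le hr0 hr1 hL0 hrL k t v
    _ ≤ (L ^ α * h ^ α) * (r * L / (r * L - 1) * 1 + 2 * r / (1 - r)) := by gcongr
    _ = _ := by ring

/-! ### Lower bound for the oscillation by Fourier localization. -/

open scoped FourierTransform SchwartzMap in
/-- There is a rapidly decreasing function whose Fourier transform is `1` at the frequency `1` and
vanishes at all frequencies that are not close to `1`. -/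
theorem exists_fourier_localized {δ : ℝ} (hδ : 0 < δ) :
    ∃ φ : ℝ → ℂ, Integrable φ ∧ Integrable (fun u => ‖u‖ ^ 2 * ‖φ u‖) ∧
      ∫ u : ℝ, Complex.exp (Complex.I * u) * φ u = 1 ∧
      ∀ η : ℝ, δ ≤ |η - 1| → ∫ u, Complex.exp (Complex.I * (η * u : ℝ)) * φ u = 0 := by
  have hpi : 0 < 2 * Real.pi := by positivity
  -- φ is the Fourier transform of a bump; Mathlib's characters e^(2πi·) put frequency η at the
  -- point η / (2π).
  let b : ContDiffBump (1 / (2 * Real.pi) : ℝ) :=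
    ⟨δ / (2 * Real.pi) / 2, δ / (2 * Real.pi), by positivity, half_lt_self (by positivity)⟩
  have hc : HasCompactSupport fun x => (b x : ℂ) :=
    b.hasCompactSupport.comp_left (g := Complex.ofReal) Complex.ofReal_zero
  have hsm : ContDiff ℝ (⊤ : ℕ∞) fun x => (b x : ℂ) :=
    Complex.ofRealCLM.contDiff.comp b.contDiff
  let ψ : 𝓢(ℝ, ℂ) := hc.toSchwartzMap hsm
  let Φ : 𝓢(ℝ, ℂ) := 𝓕 ψ
  have key : ∀ η : ℝ, ∫ u, Complex.exp (Complex.I * (η * u : ℝ)) * Φ u =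
      b (η / (2 * Real.pi)) := fun η => by
    have h1 : (𝓕⁻ Φ : 𝓢(ℝ, ℂ)) (η / (2 * Real.pi)) = ψ (η / (2 * Real.pi)) := by
      rw [FourierTransform.fourierInv_fourier_eq ψ]
    rw [SchwartzMap.fourierInv_coe, Real.fourierInv_eq'] at h1
    rw [show (b (η / (2 * Real.pi)) : ℂ) = ψ (η / (2 * Real.pi)) from rfl, ← h1]
    refine integral_congr_ae (.of_forall fun u => ?_)
    simp only [smul_eq_mul]
    congr 2
    rw [mul_comm]
    congr 2
    simp only [RCLike.inner_apply, conj_trivial]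
    field_simp
  refine ⟨Φ, Φ.integrable, Φ.integrable_pow_mul volume 2, ?_, fun η hη => ?_⟩
  · have := key 1
    simp only [one_mul] at this
    rw [this, b.one_of_mem_closedBall (Metric.mem_closedBall_self b.rIn_pos.le)]
    simp
  · rw [key, b.zero_of_le_dist, Complex.ofReal_zero]
    rw [Real.dist_eq, ← sub_div, abs_div, abs_of_pos hpi]
    exact div_le_div_of_nonneg_right hη hpi.le

/-- Only one of the two exponentials in the sine survives, since the spectrum of φ misses -η. -/
theorem integral_sin_mul_of_fourier {φ : ℝ → ℂ} (hφ : Integrable φ) (a η : ℝ) {z : ℂ}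
    (h : ∫ u, Complex.exp (Complex.I * (η * u : ℝ)) * φ u = z)
    (h0 : ∫ u, Complex.exp (Complex.I * (-η * u : ℝ)) * φ u = 0) :
    ∫ u, (Real.sin (a + η * u) : ℂ) * φ u =
      z * (Complex.exp (Complex.I * a) / (2 * Complex.I)) := by
  have hint : ∀ c : ℝ, Integrable fun u => Complex.exp (Complex.I * (c * u : ℝ)) * φ u := fun c =>
    hφ.bdd_mul (c := 1) (by fun_prop) (.of_forall fun u => by
      rw [mul_comm, Complex.norm_exp_ofReal_mul_I])
  have he : ∀ u : ℝ, (Real.sin (a + η * u) : ℂ) * φ u =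
      Complex.exp (Complex.I * a) / (2 * Complex.I) *
        (Complex.exp (Complex.I * (η * u : ℝ)) * φ u) -
      Complex.exp (-(Complex.I * a)) / (2 * Complex.I) *
        (Complex.exp (Complex.I * (-η * u : ℝ)) * φ u) := fun u => by
    have e1 : Complex.exp (Complex.I * a) * Complex.exp (Complex.I * (η * u : ℝ)) =
        Complex.exp ((a + η * u : ℂ) * Complex.I) := by
      rw [← Complex.exp_add]; push_cast; ring_nf
    have e2 : Complex.exp (-(Complex.I * a)) * Complex.exp (Complex.I * (-η * u : ℝ)) =
        Complex.exp (-(a + η * u : ℂ) * Complex.I) := by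
      rw [← Complex.exp_add]; push_cast; ring_nf
    rw [div_mul_eq_mul_div, div_mul_eq_mul_div, ← mul_assoc, ← mul_assoc, e1, e2, ← sub_div,
      ← sub_mul, Complex.ofReal_sin, Complex.sin]
    push_cast
    have := Complex.I_ne_zero
    field_simp
    rw [Complex.I_sq]
    ring
  simp_rw [he]
  rw [integral_sub ((hint η).const_mul _) ((hint (-η)).const_mul _), integral_const_mul,
    integral_const_mul, h, h0, mul_zero, sub_zero, mul_comm]

/-- Distinct powers differ by a factor of at least L, so one spectral width 1 - 1/L separates the
frequencies at all scales at once. -/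
theorem one_sub_inv_le_abs_pow_div_sub_one {L : ℝ} (hL : 1 < L) {j k : ℕ} (h : j ≠ k) :
    1 - L⁻¹ ≤ |L ^ j / L ^ k - 1| := by
  have hL0 : 0 < L := by linarith
  have h2 : 1 - L⁻¹ ≤ L - 1 := by
    have : 0 ≤ (L - 1) ^ 2 / L := by positivity
    have e : (L - 1) ^ 2 / L = L - 2 + L⁻¹ := by field_simp; ring
    linarith
  rcases lt_or_gt_of_ne h with h | h
  · rw [abs_sub_comm]
    refine le_trans ?_ (le_abs_self _)
    gcongr
    rw [div_le_iff₀ (pow_pos hL0 _), ← div_eq_inv_mul, le_div_iff₀ hL0, ← pow_succ]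
    exact pow_le_pow_right₀ hL.le h
  · refine le_trans h2 (le_trans ?_ (le_abs_self _))
    gcongr
    rw [le_div_iff₀ (pow_pos hL0 _), ← pow_succ']
    exact pow_le_pow_right₀ hL.le h

/-- After rescaling by L^(k+1), the term of index k has frequency 1 and all others lie outside the
spectrum of φ. The point τ enters only through a unimodular phase, so taking the norm makes the
value independent of τ. -/
theorem norm_integral_lacunary_sub_mul {r L : ℝ} (hr0 : 0 < r) (hr1 : r < 1) (hL : 1 < L)
    {φ : ℝ → ℂ} (hφ : Integrable φ)
    (h1 : ∫ u : ℝ, Complex.exp (Complex.I * u) * φ u = 1)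
    (h0 : ∀ η : ℝ, 1 - L⁻¹ ≤ |η - 1| → ∫ u, Complex.exp (Complex.I * (η * u : ℝ)) * φ u = 0)
    (k : ℕ) (τ : ℝ) :
    ‖∫ u, ((lacunary r L (τ + u / L ^ (k + 1)) - lacunary r L τ : ℝ) : ℂ) * φ u‖ =
      r ^ (k + 1) / 2 := by
  have hL0 : 0 < L := by linarith
  have hLi : 0 < L⁻¹ := inv_pos.2 hL0
  -- Frequency 0 is also excluded, so the constant `lacunary r L τ` integrates to 0.
  have hz : ∫ u, φ u = 0 := by
    have := h0 0 (by simp [hL0.le])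
    simpa using this
  have hneg : ∀ η : ℝ, 0 < η → ∫ u, Complex.exp (Complex.I * (-η * u : ℝ)) * φ u = 0 :=
    fun η hη => h0 (-η) (by rw [abs_of_neg (by linarith)]; linarith)
  have hi : ∀ j : ℕ, ∫ u, ((r ^ (j + 1) * Real.sin (L ^ (j + 1) * (τ + u / L ^ (k + 1))) : ℝ) : ℂ)
      * φ u = if j = k then
        r ^ (k + 1) * (Complex.exp (Complex.I * (L ^ (k + 1) * τ : ℝ)) / (2 * Complex.I)) else 0 := by
    intro j
    have e : ∀ u : ℝ, ((r ^ (j + 1) * Real.sin (L ^ (j + 1) * (τ + u / L ^ (k + 1))) : ℝ) : ℂ)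
        * φ u = (r ^ (j + 1) : ℂ) *
        ((Real.sin (L ^ (j + 1) * τ + L ^ (j + 1) / L ^ (k + 1) * u) : ℂ) * φ u) := fun u => by
      rw [mul_add, mul_div_assoc', div_mul_eq_mul_div, ← mul_assoc]
      push_cast
      rfl
    simp_rw [e]
    rw [integral_const_mul]
    split_ifs with hjk
    · subst hjk
      rw [integral_sin_mul_of_fourier hφ _ _ (z := 1) ?_ (hneg _ (by positivity)), one_mul]
      rw [div_self (pow_pos hL0 _).ne']
      simpa using h1
    · rw [integral_sin_mul_of_fourier hφ _ _
        (h0 _ (one_sub_inv_le_abs_pow_div_sub_one hL (by simpa using hjk))) (hneg _ (by positivity))]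
      simp
  have hbd : ∀ (j : ℕ) (u : ℝ),
      ‖((r ^ (j + 1) * Real.sin (L ^ (j + 1) * (τ + u / L ^ (k + 1))) : ℝ) : ℂ)‖ ≤ r ^ (j + 1) :=
    fun j u => by
      rw [Complex.norm_real]
      exact norm_lacunary_term_le hr0.le L _ j
  have hF : ∀ j : ℕ, Integrable fun u =>
      ((r ^ (j + 1) * Real.sin (L ^ (j + 1) * (τ + u / L ^ (k + 1))) : ℝ) : ℂ) * φ u := fun j =>
    hφ.bdd_mul (c := r ^ (j + 1)) (by fun_prop) (.of_forall (hbd j))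
  have hsum := hasSum_integral_of_summable_integral_norm hF
    (.of_nonneg_of_le (fun j => integral_nonneg fun u => norm_nonneg _) (fun j => by
      rw [← integral_const_mul]
      refine integral_mono (hF j).norm (hφ.norm.const_mul _) fun u => ?_
      simp only [norm_mul (α := ℂ)]
      exact mul_le_mul_of_nonneg_right (hbd j u) (norm_nonneg _))
      ((summable_pow_succ hr0.le hr1).mul_right (∫ u, ‖φ u‖)))
  have hW : ∀ u, ∑' j : ℕ, ((r ^ (j + 1) * Real.sin (L ^ (j + 1) * (τ + u / L ^ (k + 1))) : ℝ) : ℂ)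
      * φ u = (lacunary r L (τ + u / L ^ (k + 1)) : ℂ) * φ u := fun u => by
    rw [tsum_mul_right, ← Complex.ofReal_tsum]
    rfl
  simp_rw [hi, hW] at hsum
  have hval := hsum.unique (hasSum_ite_eq k _)
  have hcont := continuous_lacunary hr0.le hr1 L
  have hWint : Integrable fun u => (lacunary r L (τ + u / L ^ (k + 1)) : ℂ) * φ u := by
    refine hφ.bdd_mul (c := ∑' j : ℕ, r ^ (j + 1)) (by fun_prop) (.of_forall fun u => ?_)
    rw [Complex.norm_real]
    exact tsum_of_norm_bounded (summable_pow_succ hr0.le hr1).hasSum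
      (norm_lacunary_term_le hr0.le L _)
  simp_rw [Complex.ofReal_sub, sub_mul]
  rw [integral_sub hWint (hφ.const_mul _), integral_const_mul, hz, mul_zero, sub_zero, hval,
    norm_mul, norm_div, mul_comm Complex.I, Complex.norm_exp_ofReal_mul_I]
  simp [abs_of_pos hr0]
  ring

/-- At every scale `L ^ (-k)` and every point, the lacunary series oscillates by at least a fixed
multiple of `r ^ k`. -/
theorem exists_lacunary_osc_pow {r L : ℝ} (hr0 : 0 < r) (hr1 : r < 1) (hL : 1 < L)
    (hrL : 1 < r * L) :
    ∃ R c : ℝ, 1 ≤ R ∧ 0 < c ∧ ∀ (k : ℕ) (τ : ℝ), ∃ u : ℝ, |u| ≤ R ∧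
      c * r ^ (k + 1) ≤ |lacunary r L (τ + u / L ^ (k + 1)) - lacunary r L τ| := by
  have hL0 : 0 < L := by linarith
  obtain ⟨φ, hφ, hφ2, h1, h0⟩ := exists_fourier_localized (δ := 1 - L⁻¹)
    (sub_pos.2 (inv_lt_one_of_one_lt₀ hL))
  set M0 := ∫ u, ‖φ u‖ with hM0
  set M2 := ∫ u, ‖u‖ ^ 2 * ‖φ u‖ with hM2
  have hM0n : 0 ≤ M0 := integral_nonneg fun _ => norm_nonneg _
  have hM2n : 0 ≤ M2 := integral_nonneg fun _ => by positivity
  set K := r * L / (r * L - 1) + 2 * r / (1 - r) with hK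
  have hA : 0 < r * L / (r * L - 1) := div_pos (by linarith) (by linarith)
  have hB : 0 < 2 * r / (1 - r) := div_pos (by linarith) (by linarith)
  have hK0 : 0 < K := add_pos hA hB
  -- R makes the part |u| > R contribute at most r^(k+1) / 8. The constant 1 / (8 * (M0 + 1)) does
  -- the same for |u| ≤ R, and the total r^(k+1) / 4 is less than the exact value r^(k+1) / 2.
  set R := 1 + 8 * K * M2 with hR
  have hR1 : 1 ≤ R := by have : 0 ≤ 8 * K * M2 := by positivity
                         linarith
  refine ⟨R, 1 / (8 * (M0 + 1)), hR1, by positivity, fun k τ => ?_⟩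
  by_contra! hcon
  have hrk : 0 < r ^ (k + 1) := pow_pos hr0 _
  have hbound : ∀ u, ‖((lacunary r L (τ + u / L ^ (k + 1)) - lacunary r L τ : ℝ) : ℂ) * φ u‖ ≤
      r ^ (k + 1) * (1 / (8 * (M0 + 1)) * ‖φ u‖ + K / R * (‖u‖ ^ 2 * ‖φ u‖)) := fun u => by
    rw [norm_mul, Complex.norm_real, Real.norm_eq_abs]
    rw [show r ^ (k + 1) * (1 / (8 * (M0 + 1)) * ‖φ u‖ + K / R * (‖u‖ ^ 2 * ‖φ u‖)) =
      r ^ (k + 1) * (1 / (8 * (M0 + 1)) + K / R * ‖u‖ ^ 2) * ‖φ u‖ by ring]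
    refine mul_le_mul_of_nonneg_right ?_ (norm_nonneg _)
    rcases le_or_gt |u| R with hu | hu
    · refine (hcon u hu).le.trans ?_
      rw [mul_comm]
      gcongr
      have : 0 ≤ K / R * ‖u‖ ^ 2 := by positivity
      linarith
    · refine (abs_lacunary_sub_le hr0 hr1 hL0 hrL (k + 1) τ _).trans ?_
      rw [abs_div, abs_of_pos (pow_pos hL0 (k + 1)), mul_div_cancel₀ _ (pow_pos hL0 (k + 1)).ne']
      refine mul_le_mul_of_nonneg_left ?_ hrk.le
      have hu1 : 1 ≤ |u| := by linarith
      have h3 : r * L / (r * L - 1) * |u| + 2 * r / (1 - r) ≤ K * |u| := by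
        rw [hK, add_mul]
        nlinarith
      -- For |u| > R one factor |u| / R is given away, so that the second moment of φ pays for the
      -- linear growth.
      have h4 : K * |u| ≤ K / R * ‖u‖ ^ 2 := by
        rw [Real.norm_eq_abs, div_mul_eq_mul_div, le_div_iff₀ (by linarith), pow_two, mul_assoc]
        gcongr
      have : 0 < 1 / (8 * (M0 + 1)) := by positivity
      linarith
  have hle := norm_integral_le_of_norm_le
    (((hφ.norm.const_mul _).add (hφ2.const_mul _)).const_mul _) (.of_forall hbound)
  rw [norm_integral_lacunary_sub_mul hr0 hr1 hL hφ h1 h0, integral_const_mul] at hle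
  simp only [Pi.add_apply] at hle
  rw [integral_add (hφ.norm.const_mul _) (hφ2.const_mul _),
    integral_const_mul, integral_const_mul, ← hM0, ← hM2] at hle
  have h5 : 1 / (8 * (M0 + 1)) * M0 ≤ 1 / 8 := by
    rw [div_mul_eq_mul_div, div_le_div_iff₀ (by positivity) (by positivity)]
    linarith
  have h6 : K / R * M2 ≤ 1 / 8 := by
    rw [div_mul_eq_mul_div, div_le_div_iff₀ (by positivity) (by positivity)]
    linarith
  nlinarith

/-- On every interval of length `h ≤ h₀` the lacunary series with `r = L ^ (-α)` oscillates by at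
least `c * h ^ α`. -/
theorem exists_lacunary_osc {r L α : ℝ} (hr1 : r < 1) (hL : 1 < L) (hrL : 1 < r * L)
    (hr : r = L ^ (-α)) (hα : 0 < α) :
    ∃ h₀ c : ℝ, 0 < h₀ ∧ 0 < c ∧ ∀ h : ℝ, 0 < h → h ≤ h₀ → ∀ t : ℝ,
      ∃ x ∈ Icc t (t + h), ∃ y ∈ Icc t (t + h),
        c * h ^ α ≤ |lacunary r L x - lacunary r L y| := by
  have hL0 : 0 < L := by linarith
  have hr0 : 0 < r := hr ▸ Real.rpow_pos_of_pos hL0 _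
  obtain ⟨R, c, hR, hc, H⟩ := exists_lacunary_osc_pow hr0 hr1 hL hrL
  have hR0 : 0 < R := by linarith
  refine ⟨2 * R, c * ((2 * R * L) ^ α)⁻¹, by positivity, by positivity, fun h h0 h1 t => ?_⟩
  obtain ⟨k, hk1, hk2⟩ := exists_nat_pow_near ((one_le_div₀ h0).2 h1) hL
  have hLk : 0 < L ^ (k + 1) := pow_pos hL0 _
  -- The base point is the middle of [t, t + 2R / L^(k+1)], since the sign of u is unknown.
  obtain ⟨u, hu, hosc⟩ := H k (t + R / L ^ (k + 1))
  have hwidth : 2 * R / L ^ (k + 1) ≤ h := by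
    rw [div_lt_iff₀ h0] at hk2
    rw [div_le_iff₀ hLk]
    linarith
  have hRp : 0 < R / L ^ (k + 1) := by positivity
  have h2R : 2 * R / L ^ (k + 1) = R / L ^ (k + 1) + R / L ^ (k + 1) := by ring
  have hub : |u / L ^ (k + 1)| ≤ R / L ^ (k + 1) := by
    rw [abs_div, abs_of_pos hLk]
    gcongr
  have := abs_le.1 hub
  refine ⟨_, ⟨?_, ?_⟩, _, ⟨?_, ?_⟩, le_trans ?_ hosc⟩
  · linarith
  · linarith
  · linarith
  · linarith
  · have hrk : h ^ α ≤ (2 * R * L) ^ α * r ^ (k + 1) := by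
      rw [hr, ← Real.rpow_natCast, ← Real.rpow_mul hL0.le, neg_mul, mul_comm α, ← neg_mul,
        Real.rpow_mul hL0.le, Real.rpow_neg hL0.le, Real.rpow_natCast,
        ← Real.mul_rpow (by positivity) (by positivity)]
      refine Real.rpow_le_rpow h0.le ?_ hα.le
      rw [le_div_iff₀ h0] at hk1
      rw [pow_succ, ← div_eq_mul_inv, le_div_iff₀ (by positivity)]
      nlinarith
    calc c * ((2 * R * L) ^ α)⁻¹ * h ^ α
        ≤ c * ((2 * R * L) ^ α)⁻¹ * ((2 * R * L) ^ α * r ^ (k + 1)) := by gcongr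
      _ = c * r ^ (k + 1) := by
          have : (2 * R * L) ^ α ≠ 0 := (Real.rpow_pos_of_pos (by positivity) _).ne'
          field_simp

/-! ### Riemann-Liouville integrals of smooth and trigonometric functions. -/

theorem intervalIntegrable_inv_abs_rpow {q : ℝ} (hq : q < 1) (a b : ℝ) :
    IntervalIntegrable (fun v : ℝ => (|v| ^ q)⁻¹) volume a b := by
  refine intervalIntegrable_of_even (fun x => by simp) (fun x hx => ?_) (by simp)
    (by simp)
  refine (intervalIntegral.intervalIntegrable_rpow' (r := -q) (by linarith)).congr fun v hv => ?_
  rw [uIoc_of_le hx.le] at hv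
  simp only [abs_of_pos hv.1, Real.rpow_neg hv.1.le]

theorem intervalIntegrable_div_abs_rpow {q : ℝ} (hq : q < 1) {g : ℝ → ℝ} (hg : Continuous g)
    (a b : ℝ) : IntervalIntegrable (fun v : ℝ => g v / |v| ^ q) volume a b :=
  (intervalIntegrable_inv_abs_rpow hq a b).continuousOn_mul hg.continuousOn

theorem intervalIntegrable_div_abs_sub_rpow {q : ℝ} (hq : q < 1) {g : ℝ → ℝ} (hg : Continuous g)
    (x a b : ℝ) : IntervalIntegrable (fun u : ℝ => g u / |x - u| ^ q) volume a b := by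
  have h := (intervalIntegrable_inv_abs_rpow hq (x - a) (x - b)).comp_sub_left x
  rw [sub_sub_cancel, sub_sub_cancel] at h
  exact h.continuousOn_mul hg.continuousOn

theorem integral_inv_abs_rpow {q : ℝ} (hq : q < 1) {Y : ℝ} (hY : 0 ≤ Y) :
    ∫ v in (0 : ℝ)..Y, (|v| ^ q)⁻¹ = Y ^ (1 - q) / (1 - q) := by
  rw [intervalIntegral.integral_congr (g := fun v => v ^ (-q)), integral_rpow (.inl (by linarith)),
    Real.zero_rpow (by linarith)]
  · ring_nf
  · intro v hv
    rw [uIcc_of_le hY] at hv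
    simp only [abs_of_nonneg hv.1, Real.rpow_neg hv.1]

theorem integral_div_abs_sub_rpow (q : ℝ) (g : ℝ → ℝ) (a x : ℝ) :
    ∫ u in a..x, g u / |x - u| ^ q = ∫ v in (0 : ℝ)..x - a, g (x - v) / |v| ^ q := by
  have := intervalIntegral.integral_comp_sub_left (fun v => g (x - v) / |v| ^ q) x (a := a) (b := x)
  simpa using this

/-- Differentiation under the Riemann-Liouville integral of a smooth function that vanishes at the
base point. -/
theorem hasDerivAt_integral_div_abs_sub_rpow {q : ℝ} (hq : q < 1) {g g' : ℝ → ℝ} {M a x : ℝ}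
    (hg : ∀ u, HasDerivAt g (g' u) u) (hg' : Continuous g') (hM : ∀ u, |g' u| ≤ M)
    (ha : g a = 0) (hx : a < x) :
    HasDerivAt (fun y => ∫ u in a..y, g u / |y - u| ^ q) (∫ u in a..x, g' u / |x - u| ^ q) x := by
  have hM0 : 0 ≤ M := (abs_nonneg _).trans (hM 0)
  have hgc : Continuous g := continuous_iff_continuousAt.2 fun u => (hg u).continuousAt
  have hlip : ∀ u v, |g u - g v| ≤ M * |u - v| := fun u v =>
    (convex_univ).norm_image_sub_le_of_norm_hasDerivWithin_le
      (fun w _ => (hg w).hasDerivWithinAt) (fun w _ => hM w) (mem_univ v) (mem_univ u)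
  have hpos : ∀ v : ℝ, 0 ≤ (|v| ^ q)⁻¹ := fun v => by positivity
  -- With v = y - u the singularity stays at v = 0. Replacing y - v by max (y - v) a also fixes the
  -- range of integration: the extra part vanishes as g a = 0, and the integrand remains Lipschitz
  -- in y.
  have hmain := (intervalIntegral.hasDerivAt_integral_of_dominated_loc_of_lip (μ := volume)
    (F := fun y v => g (max (y - v) a) / |v| ^ q)
    (F' := fun v => (if v < x - a then g' (x - v) else 0) / |v| ^ q) (x₀ := x) (s := univ)
    (a := 0) (b := x - a + 1) (bound := fun v => M * (|v| ^ q)⁻¹) univ_mem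
    (.of_forall fun y => (intervalIntegrable_div_abs_rpow hq
      (g := fun v => g (max (y - v) a)) (by fun_prop) _ _).def'.aestronglyMeasurable)
    (intervalIntegrable_div_abs_rpow hq (g := fun v => g (max (x - v) a)) (by fun_prop) _ _)
    ?_ ?_ ((intervalIntegrable_inv_abs_rpow hq _ _).const_mul M) ?_).2
  · refine (hmain.congr_of_eventuallyEq ?_).congr_deriv ?_
    · filter_upwards [Ioo_mem_nhds hx (lt_add_one x)] with y hy
      rw [integral_div_abs_sub_rpow, ← intervalIntegral.integral_add_adjacent_intervals
        (b := y - a) (intervalIntegrable_div_abs_rpow hq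
          (g := fun v => g (max (y - v) a)) (by fun_prop) _ _)
        (intervalIntegrable_div_abs_rpow hq (g := fun v => g (max (y - v) a)) (by fun_prop) _ _)]
      rw [intervalIntegral.integral_congr (a := y - a) (g := fun _ => (0 : ℝ)),
        intervalIntegral.integral_zero, add_zero]
      · refine intervalIntegral.integral_congr fun v hv => ?_
        rw [uIcc_of_le (by linarith [hy.1])] at hv
        simp only [max_eq_left (show a ≤ y - v by linarith [hv.2])]
      · intro v hv
        rw [uIcc_of_le (by linarith [hy.2])] at hv
        simp only [max_eq_right (show y - v ≤ a by linarith [hv.1]), ha, zero_div]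
    · have hi1 : IntervalIntegrable (fun v => (if v < x - a then g' (x - v) else 0) / |v| ^ q)
          volume 0 (x - a) := by
        refine (intervalIntegrable_div_abs_rpow hq (g := fun v => g' (x - v)) (by fun_prop)
          0 (x - a)).congr_ae ?_
        rw [uIoc_of_le (by linarith), Filter.EventuallyEq, ae_restrict_iff' measurableSet_Ioc]
        filter_upwards [compl_mem_ae_iff.2 (measure_singleton (x - a))] with v hv hv2
        rw [if_pos (lt_of_le_of_ne hv2.2 hv)]
      have hz : EqOn (fun v => (if v < x - a then g' (x - v) else 0) / |v| ^ q) (fun _ => 0)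
          (uIcc (x - a) (x - a + 1)) := fun v hv => by
        rw [uIcc_of_le (by linarith)] at hv
        simp only [if_neg (not_lt.2 hv.1), zero_div]
      rw [integral_div_abs_sub_rpow, ← intervalIntegral.integral_add_adjacent_intervals
        (b := x - a) hi1 (intervalIntegrable_const.congr fun v hv => (hz (uIoc_subset_uIcc hv)).symm),
        intervalIntegral.integral_congr hz, intervalIntegral.integral_zero, add_zero]
      refine intervalIntegral.integral_congr_ae ?_
      filter_upwards [compl_mem_ae_iff.2 (measure_singleton (x - a))] with v hv hv2
      rw [uIoc_of_le (by linarith)] at hv2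
      rw [if_pos (lt_of_le_of_ne hv2.2 hv)]
  · refine Measurable.aestronglyMeasurable (Measurable.div ?_ (by fun_prop))
    exact Measurable.ite measurableSet_Iio (by fun_prop) measurable_const
  · refine .of_forall fun v _ => LipschitzOnWith.of_dist_le_mul fun y _ z _ => ?_
    rw [Real.coe_nnabs, abs_of_nonneg (mul_nonneg hM0 (hpos v)), Real.dist_eq, Real.dist_eq,
      ← sub_div, abs_div, abs_of_nonneg (show 0 ≤ |v| ^ q by positivity), div_eq_mul_inv,
      mul_right_comm]
    refine mul_le_mul_of_nonneg_right ((hlip _ _).trans (mul_le_mul_of_nonneg_left ?_ hM0)) (hpos v)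
    have := abs_max_sub_max_le_abs (y - v) (z - v) a
    rwa [sub_sub_sub_cancel_right] at this
  · filter_upwards [compl_mem_ae_iff.2 (measure_singleton (x - a))] with v hv _
    refine HasDerivAt.div_const ?_ _
    split_ifs with h
    · have h1 : HasDerivAt (fun y => g (y - v)) (g' (x - v)) x := (hg (x - v)).comp_sub_const x v
      refine h1.congr_of_eventuallyEq ?_
      filter_upwards [lt_mem_nhds (show a + v < x by linarith)] with y hy
      rw [max_eq_left (by linarith)]
    · refine (hasDerivAt_const x (0 : ℝ)).congr_of_eventuallyEq ?_
      have : x - a < v := lt_of_le_of_ne (not_lt.1 h) (Ne.symm hv)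
      filter_upwards [gt_mem_nhds (show x < a + v by linarith)] with y hy
      rw [max_eq_right (by linarith), ha]

theorem abs_integral_div_abs_rpow_le {q : ℝ} (hq : q < 1) {g : ℝ → ℝ} {M Y : ℝ}
    (hM : ∀ u, |g u| ≤ M) (hY : 0 ≤ Y) :
    |∫ v in (0 : ℝ)..Y, g v / |v| ^ q| ≤ M * (Y ^ (1 - q) / (1 - q)) := by
  rw [← integral_inv_abs_rpow hq hY, ← intervalIntegral.integral_const_mul, ← Real.norm_eq_abs]
  refine intervalIntegral.norm_integral_le_of_norm_le hY (.of_forall fun v _ => ?_)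
    ((intervalIntegrable_inv_abs_rpow hq _ _).const_mul M)
  rw [Real.norm_eq_abs, abs_div, abs_of_nonneg (show 0 ≤ |v| ^ q by positivity), div_eq_mul_inv]
  exact mul_le_mul_of_nonneg_right (hM v) (by positivity)

/-- Not uniform in ω, but it vanishes as x → a: it gives the limit of each single term. -/
theorem abs_integral_cos_div_abs_sub_rpow_le {q : ℝ} (hq : q < 1) (ω : ℝ) {a x : ℝ} (hx : a ≤ x) :
    |∫ u in a..x, ω * Real.cos (ω * u) / |x - u| ^ q| ≤
      |ω| * ((x - a) ^ (1 - q) / (1 - q)) := by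
  rw [integral_div_abs_sub_rpow]
  refine abs_integral_div_abs_rpow_le (g := fun v => ω * Real.cos (ω * (x - v))) hq (fun v => ?_)
    (sub_nonneg.2 hx)
  rw [abs_mul]
  exact mul_le_of_le_one_right (abs_nonneg _) (Real.abs_cos_le_one _)

/-- Integration by parts: the boundary terms give δ^(-q) + Y^(-q), and the decrease of v^(-q) gives
δ^(-q) - Y^(-q). -/
theorem abs_integral_cos_div_abs_rpow_tail_le {q : ℝ} (hq0 : 0 < q) {ω x δ Y : ℝ}
    (hδ : 0 < δ) (hY : δ ≤ Y) :
    |∫ v in δ..Y, ω * Real.cos (ω * (x - v)) / |v| ^ q| ≤ 2 * δ ^ (-q) := by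
  have hpos : ∀ v ∈ uIcc δ Y, 0 < v := fun v hv => by
    rw [uIcc_of_le hY] at hv
    linarith [hv.1]
  have hu : ∀ v ∈ uIcc δ Y, HasDerivAt (fun v : ℝ => v ^ (-q)) (-q * v ^ (-q - 1)) v :=
    fun v hv => Real.hasDerivAt_rpow_const (.inl (hpos v hv).ne')
  have hv' : ∀ v ∈ uIcc δ Y, HasDerivAt (fun v : ℝ => -Real.sin (ω * (x - v)))
      (ω * Real.cos (ω * (x - v))) v := fun v _ => by
    have h1 : HasDerivAt (fun v : ℝ => ω * (x - v)) (-ω) v := by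
      simpa using ((hasDerivAt_id v).const_sub x).const_mul ω
    exact h1.sin.neg.congr_deriv (by ring)
  have hui : IntervalIntegrable (fun v : ℝ => -q * v ^ (-q - 1)) volume δ Y :=
    ContinuousOn.intervalIntegrable (continuousOn_const.mul
      (continuousOn_id.rpow_const fun v hv => .inl (hpos v hv).ne'))
  have hparts := intervalIntegral.integral_mul_deriv_eq_deriv_mul hu hv' hui
    (Continuous.intervalIntegrable (by fun_prop) _ _)
  rw [intervalIntegral.integral_congr
    (g := fun v => v ^ (-q) * (ω * Real.cos (ω * (x - v)))), hparts]
  · have hrest : |∫ v in δ..Y, -q * v ^ (-q - 1) * -Real.sin (ω * (x - v))| ≤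
        δ ^ (-q) - Y ^ (-q) := by
      have hI : ∫ v in δ..Y, -(-q * v ^ (-q - 1)) = δ ^ (-q) - Y ^ (-q) := by
        rw [intervalIntegral.integral_neg, intervalIntegral.integral_eq_sub_of_hasDerivAt hu hui]
        ring
      rw [← hI, ← Real.norm_eq_abs]
      refine intervalIntegral.norm_integral_le_of_norm_le hY (.of_forall fun v hv => ?_) hui.neg
      have h0 : 0 < v := hδ.trans hv.1
      rw [norm_mul, norm_mul, norm_neg, norm_neg, Real.norm_of_nonneg hq0.le,
        Real.norm_of_nonneg (Real.rpow_nonneg h0.le _), neg_mul, neg_neg]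
      exact mul_le_of_le_one_right (by positivity) (Real.abs_sin_le_one _)
    have hY0 : 0 ≤ Y ^ (-q) := Real.rpow_nonneg (by linarith) _
    have hδ0 : 0 ≤ δ ^ (-q) := Real.rpow_nonneg hδ.le _
    have b1 : |Y ^ (-q) * -Real.sin (ω * (x - Y))| ≤ Y ^ (-q) := by
      rw [abs_mul, abs_neg, abs_of_nonneg hY0]
      exact mul_le_of_le_one_right hY0 (Real.abs_sin_le_one _)
    have b2 : |δ ^ (-q) * -Real.sin (ω * (x - δ))| ≤ δ ^ (-q) := by
      rw [abs_mul, abs_neg, abs_of_nonneg hδ0]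
      exact mul_le_of_le_one_right hδ0 (Real.abs_sin_le_one _)
    rw [abs_le] at *
    constructor <;> linarith [b1.1, b1.2, b2.1, b2.2, hrest.1, hrest.2]
  · intro v hv
    simp only [abs_of_pos (hpos v hv), Real.rpow_neg (hpos v hv).le, div_eq_mul_inv]
    ring

/-- Split at distance 1/ω from the singularity: size alone suffices inside, cancellation is used
outside, and both parts are of order ω^q, uniformly in x. -/
theorem abs_integral_cos_div_abs_sub_rpow_le' {q : ℝ} (hq0 : 0 < q) (hq : q < 1) {ω a x : ℝ}
    (hω : 0 < ω) (hx : a ≤ x) :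
    |∫ u in a..x, ω * Real.cos (ω * u) / |x - u| ^ q| ≤ (1 / (1 - q) + 2) * ω ^ q := by
  have hq1 : 0 < 1 - q := by linarith
  have hωq : 0 < ω ^ q := Real.rpow_pos_of_pos hω _
  have hshort : ∀ Y, 0 ≤ Y → Y ≤ ω⁻¹ → ω * (Y ^ (1 - q) / (1 - q)) ≤ 1 / (1 - q) * ω ^ q :=
    fun Y hY0 hY => by
      have : Y ^ (1 - q) ≤ ω ^ q / ω := by
        rw [← Real.rpow_sub_one hω.ne', ← neg_sub 1 q, Real.rpow_neg hω.le, ← Real.inv_rpow hω.le]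
        exact Real.rpow_le_rpow hY0 hY hq1.le
      calc _ ≤ ω * (ω ^ q / ω / (1 - q)) := by gcongr
        _ = _ := by field_simp
  rcases le_or_gt (x - a) ω⁻¹ with h | h
  · have h1 := abs_integral_cos_div_abs_sub_rpow_le hq ω hx
    rw [abs_of_pos hω] at h1
    linarith [hshort _ (sub_nonneg.2 hx) h]
  · have hωi : 0 < ω⁻¹ := inv_pos.2 hω
    rw [integral_div_abs_sub_rpow, ← intervalIntegral.integral_add_adjacent_intervals (b := ω⁻¹)
      (intervalIntegrable_div_abs_rpow hq (g := fun v => ω * Real.cos (ω * (x - v)))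
        (by fun_prop) _ _)
      (intervalIntegrable_div_abs_rpow hq (g := fun v => ω * Real.cos (ω * (x - v)))
        (by fun_prop) _ _), add_mul]
    refine (abs_add_le _ _).trans (add_le_add ?_ ?_)
    · refine (abs_integral_div_abs_rpow_le (g := fun v => ω * Real.cos (ω * (x - v))) (M := ω) hq
        (fun v => ?_) hωi.le).trans (hshort _ hωi.le le_rfl)
      rw [abs_mul, abs_of_pos hω]
      exact mul_le_of_le_one_right hω.le (Real.abs_cos_le_one _)
    · refine (abs_integral_cos_div_abs_rpow_tail_le hq0 hωi h.le).trans (le_of_eq ?_)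
      rw [Real.inv_rpow hω.le, Real.rpow_neg hω.le, inv_inv]

/-! ### Existence of the local fractional derivative for q < α. -/

theorem hasSum_integral_lacunary_sub {r L q : ℝ} (hr0 : 0 < r) (hr1 : r < 1) (hq : q < 1)
    (a x : ℝ) :
    HasSum (fun j : ℕ => ∫ u in a..x,
      (r ^ (j + 1) * (Real.sin (L ^ (j + 1) * u) - Real.sin (L ^ (j + 1) * a))) / |x - u| ^ q)
      (∫ u in a..x, (lacunary r L u - lacunary r L a) / |x - u| ^ q) := by
  refine intervalIntegral.hasSum_integral_of_dominated_convergence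
    (fun j u => r ^ (j + 1) * (2 / |x - u| ^ q))
    (fun j => (intervalIntegrable_div_abs_sub_rpow hq (g := fun u => r ^ (j + 1) *
      (Real.sin (L ^ (j + 1) * u) - Real.sin (L ^ (j + 1) * a))) (by fun_prop) _ _ _).def'.aestronglyMeasurable)
    (fun j => .of_forall fun u _ => ?_)
    (.of_forall fun u _ => (summable_pow_succ hr0.le hr1).mul_right _) ?_
    (.of_forall fun u _ => ?_)
  · rw [norm_div, norm_mul, Real.norm_of_nonneg (pow_nonneg hr0.le _), Real.norm_of_nonneg
      (show 0 ≤ |x - u| ^ q by positivity), mul_div_assoc]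
    gcongr
    refine (norm_sub_le _ _).trans ?_
    simp only [Real.norm_eq_abs]
    linarith [Real.abs_sin_le_one (L ^ (j + 1) * u), Real.abs_sin_le_one (L ^ (j + 1) * a)]
  · simp_rw [tsum_mul_right]
    exact (intervalIntegrable_div_abs_sub_rpow hq (g := fun _ => 2) continuous_const _ _ _).const_mul _
  · have := (summable_lacunary hr0.le hr1 L u).hasSum.sub (summable_lacunary hr0.le hr1 L a).hasSum
    simp_rw [mul_sub]
    exact this.div_const _

/-- The condition r L^q < 1 makes the series of derivatives converge uniformly on x > τ. The same
majorant justifies both the termwise differentiation and the termwise limit. -/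
theorem hasLFDWithin_lacunary_Ici {r L q : ℝ} (hr0 : 0 < r) (hr1 : r < 1) (hL : 0 < L)
    (hq0 : 0 < q) (hq : q < 1) (hrLq : r * L ^ q < 1) (τ : ℝ) :
    HasLFDWithin q (lacunary r L) (Ici τ) 0 τ := by
  have hIci : Ici τ \ {τ} = Ioi τ := Ici_sdiff_left
  have hcont := continuous_lacunary hr0.le hr1 L
  set C := 1 / (1 - q) + 2 with hC
  have hC0 : 0 < C := by have : 0 < 1 - q := by linarith
                         positivity
  set d : ℕ → ℝ → ℝ := fun j x =>
    r ^ (j + 1) * ∫ u in τ..x, L ^ (j + 1) * Real.cos (L ^ (j + 1) * u) / |x - u| ^ q with hd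
  have hsum : Summable fun j : ℕ => C * (r * L ^ q) ^ (j + 1) :=
    (summable_pow_succ (by positivity) hrLq).mul_left C
  have hbound : ∀ (j : ℕ) (x : ℝ), x ∈ Ioi τ → ‖d j x‖ ≤ C * (r * L ^ q) ^ (j + 1) := fun j x hx => by
    rw [hd, norm_mul, Real.norm_of_nonneg (pow_nonneg hr0.le _), Real.norm_eq_abs]
    calc _ ≤ r ^ (j + 1) * (C * (L ^ (j + 1)) ^ q) := by
          gcongr
          exact abs_integral_cos_div_abs_sub_rpow_le' hq0 hq (pow_pos hL _) (le_of_lt hx)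
      _ = _ := by
          rw [mul_pow, ← Real.rpow_natCast (L ^ q), ← Real.rpow_mul hL.le, mul_comm q,
            Real.rpow_mul hL.le, Real.rpow_natCast]
          ring
  have hderiv : ∀ x ∈ Ioi τ, HasDerivAt
      (fun y => ∫ u in τ..y, (lacunary r L u - lacunary r L τ) / |y - u| ^ q)
      (∑' j, d j x) x := fun x hx => by
    simp_rw [← (hasSum_integral_lacunary_sub hr0 hr1 hq τ _).tsum_eq]
    refine hasDerivAt_tsum_of_isPreconnected hsum isOpen_Ioi isPreconnected_Ioi
      (fun j y hy => ?_) hbound hx (hasSum_integral_lacunary_sub hr0 hr1 hq τ x).summable hx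
    refine (hasDerivAt_integral_div_abs_sub_rpow hq (M := r ^ (j + 1) * L ^ (j + 1))
      (g' := fun u => r ^ (j + 1) * (L ^ (j + 1) * Real.cos (L ^ (j + 1) * u)))
      (fun u => ?_) (by fun_prop) (fun u => ?_) (by simp) hy).congr_deriv ?_
    · have h1 : HasDerivAt (fun u : ℝ => L ^ (j + 1) * u) (L ^ (j + 1)) u := by
        simpa using (hasDerivAt_id u).const_mul (L ^ (j + 1))
      exact ((h1.sin.sub_const _).const_mul _).congr_deriv (by ring)
    · rw [← mul_assoc, abs_mul, abs_of_nonneg (by positivity : 0 ≤ r ^ (j + 1) * L ^ (j + 1))]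
      exact mul_le_of_le_one_right (by positivity) (Real.abs_cos_le_one _)
    · simp_rw [mul_div_assoc (r ^ (j + 1))]
      exact intervalIntegral.integral_const_mul _ _
  refine ⟨fun x => 1 / Real.Gamma (1 - q) * ∑' j, d j x, ?_, ?_⟩
  · rw [hIci]
    filter_upwards [self_mem_nhdsWithin] with x hx
    exact ⟨.of_forall fun y => intervalIntegrable_div_abs_sub_rpow hq (by fun_prop) _ _ _,
      (hderiv x hx).const_mul _⟩
  · rw [hIci]
    have ht : Tendsto (fun x => ∑' j, d j x) (𝓝[>] τ) (𝓝 (∑' _ : ℕ, (0 : ℝ))) := by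
      refine tendsto_tsum_of_dominated_convergence hsum (fun j => ?_)
        (eventually_nhdsWithin_of_forall fun x hx j => hbound j x hx)
      have h0 : Tendsto (fun x : ℝ => r ^ (j + 1) * (|L ^ (j + 1)| *
          ((x - τ) ^ (1 - q) / (1 - q)))) (𝓝[>] τ) (𝓝 0) := by
        have hc : Continuous fun x : ℝ => r ^ (j + 1) * (|L ^ (j + 1)| *
            ((x - τ) ^ (1 - q) / (1 - q))) :=
          continuous_const.mul (continuous_const.mul
            (((continuous_id.sub continuous_const).rpow_const
              fun _ => .inr (by linarith)).div_const _))
        have := (hc.tendsto τ).mono_left (nhdsWithin_le_nhds (s := Ioi τ))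
        simpa [Real.zero_rpow (show 1 - q ≠ 0 by linarith)] using this
      refine squeeze_zero_norm' (eventually_nhdsWithin_of_forall fun x hx => ?_) h0
      rw [hd, norm_mul, Real.norm_of_nonneg (pow_nonneg hr0.le _), Real.norm_eq_abs]
      gcongr
      exact abs_integral_cos_div_abs_sub_rpow_le hq _ (le_of_lt hx)
    simpa using ht.const_mul (1 / Real.Gamma (1 - q))

/-! ### Abel inversion and the Hölder consequence of existence. -/

/-- The Beta integral `B(1 - q, q) = ∫_0^1 v^{-q} (1 - v)^{q - 1} dv`. -/
noncomputable def abelConst (q : ℝ) : ℝ :=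
  ∫ v in (0 : ℝ)..1, (|v| ^ q)⁻¹ * (|1 - v| ^ (1 - q))⁻¹

theorem abelConst_pos {q : ℝ} (hq0 : 0 < q) (hq : q < 1) : 0 < abelConst q := by
  refine intervalIntegral.intervalIntegral_pos_of_pos_on ?_ (fun v hv => ?_) one_pos
  · have h := (Complex.betaIntegral_convergent (u := (1 - q : ℝ)) (v := q)
      (by simpa using hq) (by simpa using hq0)).norm
    rw [intervalIntegrable_iff_integrableOn_Ioo_of_le zero_le_one] at h ⊢
    refine h.congr_fun (fun v hv => ?_) measurableSet_Ioo
    have h1 : 0 < 1 - v := sub_pos.2 hv.2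
    simp only [norm_mul]
    rw [show (1 - (v : ℂ)) = ((1 - v : ℝ) : ℂ) by push_cast; rfl, Complex.norm_cpow_eq_rpow_re_of_pos hv.1,
      Complex.norm_cpow_eq_rpow_re_of_pos h1, abs_of_pos hv.1, abs_of_pos h1,
      ← Real.rpow_neg hv.1.le, ← Real.rpow_neg h1.le]
    congr 2 <;> simp
  · have h1 : 0 < 1 - v := sub_pos.2 hv.2
    have h0 := hv.1
    positivity

/-- The kernel is homogeneous of degree -1, as q + (1 - q) = 1, so scaling removes w. -/
theorem integral_abel_kernel (q : ℝ) {w : ℝ} (hw : 0 < w) :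
    ∫ v in (0 : ℝ)..w, (|v| ^ q)⁻¹ * (|w - v| ^ (1 - q))⁻¹ = abelConst q := by
  have h := intervalIntegral.smul_integral_comp_mul_left (a := 0) (b := 1)
    (fun v : ℝ => (|v| ^ q)⁻¹ * (|w - v| ^ (1 - q))⁻¹) w
  rw [mul_zero, mul_one] at h
  rw [← h, smul_eq_mul, ← intervalIntegral.integral_const_mul]
  refine intervalIntegral.integral_congr fun v _ => ?_
  rw [show w - w * v = w * (1 - v) by ring, abs_mul, abs_mul, abs_of_pos hw,
    Real.mul_rpow hw.le (abs_nonneg _), Real.mul_rpow hw.le (abs_nonneg _), mul_inv, mul_inv]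
  have : w * ((w ^ q)⁻¹ * (w ^ (1 - q))⁻¹) = 1 := by
    rw [← mul_inv, ← Real.rpow_add hw, add_sub_cancel, Real.rpow_one, mul_inv_cancel₀ hw.ne']
  calc _ = w * ((w ^ q)⁻¹ * (w ^ (1 - q))⁻¹) * ((|v| ^ q)⁻¹ * (|1 - v| ^ (1 - q))⁻¹) := by ring
    _ = _ := by rw [this, one_mul]

theorem intervalIntegral_eq_integral_indicator_Ioo {a b : ℝ} (hab : a ≤ b) (f : ℝ → ℝ) :
    ∫ u in a..b, f u = ∫ u, (Ioo a b).indicator f u := by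
  rw [intervalIntegral.integral_of_le hab, integral_Ioc_eq_integral_Ioo,
    integral_indicator measurableSet_Ioo]

/-- Abel's inversion formula. -/
theorem abel_inversion {q : ℝ} (hq0 : 0 < q) (hq : q < 1) {g : ℝ → ℝ} (hg : Continuous g)
    {a X : ℝ} (hX : a < X) :
    ∫ y in a..X, (∫ u in a..y, g u / |y - u| ^ q) / |X - y| ^ (1 - q) =
      abelConst q * ∫ u in a..X, g u := by
  set T := X - a with hT
  have hT0 : 0 < T := sub_pos.2 hX
  -- Truncation to (0, T) makes the kernels integrable on the line without changing the convolutions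
  -- at the points that matter. The formula is then associativity: (f * k_q) * k_(1-q) = f * (k_q *
  -- k_(1-q)), whose inner convolution is constant on (0, T).
  let k : ℝ → ℝ → ℝ := fun p => (Ioo 0 T).indicator fun v => (|v| ^ p)⁻¹
  let f : ℝ → ℝ := (Ioo a X).indicator g
  have hk0 : ∀ p v, 0 ≤ k p v := fun p v => indicator_nonneg (fun v _ => by positivity) v
  have hkint : ∀ p, p < 1 → Integrable (k p) := fun p hp => by
    rw [integrable_indicator_iff measurableSet_Ioo,
      ← intervalIntegrable_iff_integrableOn_Ioo_of_le hT0.le]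
    exact intervalIntegrable_inv_abs_rpow hp _ _
  have hfint : Integrable f := by
    rw [integrable_indicator_iff measurableSet_Ioo,
      ← intervalIntegrable_iff_integrableOn_Ioo_of_le hX.le]
    exact hg.intervalIntegrable _ _
  have hkk : ∀ w ∈ Ioo 0 T, ∫ t, k q t * k (1 - q) (w - t) = abelConst q := fun w hw => by
    rw [← integral_abel_kernel q hw.1, intervalIntegral_eq_integral_indicator_Ioo hw.1.le]
    congr 1
    funext t
    by_cases ht : t ∈ Ioo 0 w
    · have h1 : t ∈ Ioo 0 T := ⟨ht.1, ht.2.trans hw.2⟩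
      have h2 : w - t ∈ Ioo 0 T := ⟨sub_pos.2 ht.2, by linarith [ht.1, hw.2]⟩
      simp only [k, indicator_of_mem h1, indicator_of_mem h2, indicator_of_mem ht]
    · rw [indicator_of_notMem ht]
      by_cases h1 : t ∈ Ioo 0 T
      · have h2 : w - t ∉ Ioo 0 T := fun h2 => ht ⟨h1.1, sub_pos.1 h2.1⟩
        simp only [k, indicator_of_notMem h2, mul_zero]
      · simp only [k, indicator_of_notMem h1, zero_mul]
  have hfk : ∀ y ∈ Ioo a X, ∫ u, f u * k q (y - u) = ∫ u in a..y, g u / |y - u| ^ q :=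
    fun y hy => by
      rw [intervalIntegral_eq_integral_indicator_Ioo hy.1.le]
      congr 1
      funext u
      by_cases hu : u ∈ Ioo a y
      · have h1 : u ∈ Ioo a X := ⟨hu.1, hu.2.trans hy.2⟩
        have h2 : y - u ∈ Ioo 0 T := ⟨sub_pos.2 hu.2, by linarith [hu.1, hy.2]⟩
        simp only [f, k, indicator_of_mem h1, indicator_of_mem h2, indicator_of_mem hu,
          div_eq_mul_inv]
      · rw [indicator_of_notMem hu]
        by_cases h1 : u ∈ Ioo a X
        · have h2 : y - u ∉ Ioo 0 T := fun h2 => hu ⟨h1.1, sub_pos.1 h2.1⟩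
          simp only [k, indicator_of_notMem h2, mul_zero]
        · simp only [f, indicator_of_notMem h1, zero_mul]
  have hmem : ∀ y, X - y ∈ Ioo 0 T ↔ y ∈ Ioo a X := fun y =>
    ⟨fun h => ⟨by linarith [h.2], by linarith [h.1]⟩, fun h => ⟨by linarith [h.2], by linarith [h.1]⟩⟩
  have hassoc := convolution_assoc (μ := volume) (ν := volume) (f := f) (g := k q) (k := k (1 - q))
    (ContinuousLinearMap.mul ℝ ℝ) (ContinuousLinearMap.mul ℝ ℝ) (ContinuousLinearMap.mul ℝ ℝ)
    (ContinuousLinearMap.mul ℝ ℝ) (x₀ := X) (fun x y z => mul_assoc x y z)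
    hfint.aestronglyMeasurable (hkint q hq).aestronglyMeasurable
    (hkint (1 - q) (by linarith)).aestronglyMeasurable
    (hfint.ae_convolution_exists _ (hkint q hq))
    ((hkint q hq).norm.ae_convolution_exists _ (hkint (1 - q) (by linarith)).norm) ?_
  · simp only [convolution_mul] at hassoc
    rw [intervalIntegral_eq_integral_indicator_Ioo hX.le,
      intervalIntegral_eq_integral_indicator_Ioo hX.le, ← integral_const_mul]
    refine Eq.trans (integral_congr_ae (.of_forall fun y => ?_))
      (hassoc.trans (integral_congr_ae (.of_forall fun u => ?_)))
    · by_cases hy : y ∈ Ioo a X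
      · simp only [indicator_of_mem hy, hfk y hy]
        simp only [k, indicator_of_mem ((hmem y).2 hy), div_eq_mul_inv]
      · simp only [indicator_of_notMem hy]
        simp only [k, indicator_of_notMem (fun h => hy ((hmem y).1 h)), mul_zero]
    · by_cases hu : u ∈ Ioo a X
      · simp only [f, indicator_of_mem hu, hkk _ ((hmem u).2 hu), mul_comm]
      · simp only [f, indicator_of_notMem hu, zero_mul, mul_zero]
  · simp only [ConvolutionExistsAt, convolution_mul, ContinuousLinearMap.mul_apply',
      Real.norm_of_nonneg (hk0 _ _)]
    refine (hfint.norm.mul_const (abelConst q)).congr (.of_forall fun u => ?_)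
    by_cases hu : u ∈ Ioo a X
    · simp only [hkk _ ((hmem u).2 hu)]
    · simp only [f, indicator_of_notMem hu, norm_zero, zero_mul]

/-- The mean value inequality holds in the open interval; continuity from the right carries it to
the endpoint, where no derivative is available. -/
theorem abs_sub_le_of_hasDerivAt_Ioo {F D : ℝ → ℝ} {a b M : ℝ} (hF0 : F a = 0)
    (hF : Tendsto F (𝓝[>] a) (𝓝 0)) (hD : ∀ x ∈ Ioo a b, HasDerivAt F (D x) x)
    (hM : ∀ x ∈ Ioo a b, |D x| ≤ M) {x y : ℝ} (hx : x ∈ Ico a b) (hy : y ∈ Ico a b) :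
    |F x - F y| ≤ M * |x - y| := by
  have hoo : ∀ x ∈ Ioo a b, ∀ y ∈ Ioo a b, |F x - F y| ≤ M * |x - y| := fun x hx y hy =>
    (convex_Ioo a b).norm_image_sub_le_of_norm_hasDerivWithin_le
      (fun w hw => (hD w hw).hasDerivWithinAt) hM hy hx
  have hcoo : ∀ x ∈ Ioo a b, |F x - F a| ≤ M * |x - a| := fun x hx => by
    rw [hF0]
    have h1 : Tendsto (fun y => |F x - F y|) (𝓝[>] a) (𝓝 |F x - 0|) := (hF.const_sub _).abs
    have h2 : Tendsto (fun y => M * |x - y|) (𝓝[>] a) (𝓝 (M * |x - a|)) := by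
      have hc : Continuous fun y => M * |x - y| := by fun_prop
      exact (hc.tendsto a).mono_left nhdsWithin_le_nhds
    refine le_of_tendsto_of_tendsto h1 h2 ?_
    filter_upwards [Ioo_mem_nhdsGT (hx.1.trans hx.2)] with y hy using hoo x hx y hy
  rcases eq_or_lt_of_le hx.1 with rfl | hx1
  · rcases eq_or_lt_of_le hy.1 with rfl | hy1
    · simp
    · rw [abs_sub_comm, abs_sub_comm a]
      exact hcoo y ⟨hy1, hy.2⟩
  · rcases eq_or_lt_of_le hy.1 with rfl | hy1
    · exact hcoo x ⟨hx1, hx.2⟩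
    · exact hoo x ⟨hx1, hx.2⟩ y ⟨hy1, hy.2⟩

/-- A bounded continuous function that has a local fractional derivative of order `q` from the right
at `τ` is Hölder of exponent `q` from the right at `τ`. -/
theorem exists_abs_sub_le_of_LFDExistsWithin_Ici {f : ℝ → ℝ} (hf : Continuous f) {A : ℝ}
    (hA : ∀ x, |f x| ≤ A) {q τ : ℝ} (hq0 : 0 < q) (hq : q < 1)
    (h : LFDExistsWithin q f (Ici τ) τ) :
    ∃ K δ : ℝ, 0 < K ∧ 0 < δ ∧ ∀ x, τ < x → x < τ + δ → |f x - f τ| ≤ K * (x - τ) ^ q := by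
  obtain ⟨ℓ, D, hD, hlim⟩ := h
  rw [Ici_sdiff_left] at hD hlim
  have hΓ : 0 < Real.Gamma (1 - q) := Real.Gamma_pos_of_pos (by linarith)
  have hq1 : 0 < 1 - q := by linarith
  set g : ℝ → ℝ := fun u => f u - f τ with hgdef
  have hg : Continuous g := by fun_prop
  have hg2 : ∀ u, |g u| ≤ 2 * A := fun u => by
    have := abs_sub (f u) (f τ)
    linarith [hA u, hA τ]
  have hgτ : g τ = 0 := sub_self _
  set F : ℝ → ℝ := fun y => ∫ u in τ..y, g u / |y - u| ^ q with hF
  have hFτ : F τ = 0 := by simp [hF]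
  have hbd : ∀ᶠ x in 𝓝[>] τ, |D x| < |ℓ| + 1 := hlim.abs.eventually_lt_const (by linarith)
  obtain ⟨b, hb, hbsub⟩ := mem_nhdsGT_iff_exists_Ioo_subset.1 (hD.and hbd)
  have hb' : τ < b := hb
  set M := Real.Gamma (1 - q) * (|ℓ| + 1) with hM
  have hM0 : 0 < M := by positivity
  have hFD : ∀ x ∈ Ioo τ b, HasDerivAt F (Real.Gamma (1 - q) * D x) x := fun x hx => by
    have h1 := ((hbsub hx).1.2).const_mul (Real.Gamma (1 - q))
    refine h1.congr_of_eventuallyEq (.of_forall fun y => ?_)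
    simp only [rlIntegral, hF]
    rw [← mul_assoc, mul_one_div_cancel hΓ.ne', one_mul]
  have hFM : ∀ x ∈ Ioo τ b, |Real.Gamma (1 - q) * D x| ≤ M := fun x hx => by
    rw [abs_mul, abs_of_pos hΓ]
    exact mul_le_mul_of_nonneg_left (hbsub hx).2.le hΓ.le
  have hF0 : Tendsto F (𝓝[>] τ) (𝓝 0) := by
    have h0 : Tendsto (fun x : ℝ => 2 * A * ((x - τ) ^ (1 - q) / (1 - q))) (𝓝[>] τ) (𝓝 0) := by
      have hc : Continuous fun x : ℝ => 2 * A * ((x - τ) ^ (1 - q) / (1 - q)) :=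
        continuous_const.mul (((continuous_id.sub continuous_const).rpow_const
          fun _ => .inr hq1.le).div_const _)
      have := (hc.tendsto τ).mono_left (nhdsWithin_le_nhds (s := Ioi τ))
      simpa [Real.zero_rpow hq1.ne'] using this
    refine squeeze_zero_norm' (eventually_nhdsWithin_of_forall fun x hx => ?_) h0
    change ‖∫ u in τ..x, g u / |x - u| ^ q‖ ≤ _
    rw [integral_div_abs_sub_rpow]
    exact abs_integral_div_abs_rpow_le (g := fun v => g (x - v)) hq (fun v => hg2 _)
      (sub_nonneg.2 (le_of_lt hx))
  have hLip : ∀ x ∈ Ico τ b, ∀ y ∈ Ico τ b, |F x - F y| ≤ M * |x - y| := fun x hx y hy =>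
    abs_sub_le_of_hasDerivAt_Ioo hFτ hF0 hFD hFM hx hy
  have hFc : ContinuousOn F (Ico τ b) :=
    (LipschitzOnWith.of_dist_le_mul (K := ⟨M, hM0.le⟩) fun x hx y hy => hLip x hx y hy).continuousOn
  set B := abelConst q with hB
  have hB0 : 0 < B := abelConst_pos hq0 hq
  -- Since F τ = 0, Abel inversion can be written over a range [0, T] that does not depend on y, so
  -- increments in y fall on F alone.
  have hext : ∀ T y, 0 ≤ T → τ < y → y ≤ τ + T → τ + T < b →
      IntervalIntegrable (fun v => F (max (y - v) τ) / |v| ^ (1 - q)) volume 0 T ∧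
      B * ∫ u in τ..y, g u = ∫ v in (0 : ℝ)..T, F (max (y - v) τ) / |v| ^ (1 - q) := by
    intro T y hT hy hyT hTb
    have hci : ∀ c d, 0 ≤ c → c ≤ d → IntervalIntegrable
        (fun v => F (max (y - v) τ) / |v| ^ (1 - q)) volume c d := fun c d hc hcd =>
      (intervalIntegrable_inv_abs_rpow (by linarith) c d).continuousOn_mul
        (hFc.comp (Continuous.continuousOn (by fun_prop)) fun v hv => by
          rw [uIcc_of_le hcd] at hv
          exact ⟨le_max_right _ _, max_lt (by linarith [hv.1]) hb⟩)
    refine ⟨hci 0 T le_rfl hT, ?_⟩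
    rw [← abel_inversion hq0 hq hg hy, integral_div_abs_sub_rpow,
      ← intervalIntegral.integral_add_adjacent_intervals (hci 0 (y - τ) le_rfl (by linarith))
        (hci (y - τ) T (by linarith) (by linarith)),
      intervalIntegral.integral_congr (a := y - τ) (g := fun _ => (0 : ℝ)),
      intervalIntegral.integral_zero, add_zero]
    · refine intervalIntegral.integral_congr fun v hv => ?_
      rw [uIcc_of_le (by linarith)] at hv
      simp only [max_eq_left (show τ ≤ y - v by linarith [hv.2])]
      rfl
    · intro v hv
      rw [uIcc_of_le (by linarith)] at hv
      simp only [max_eq_right (show y - v ≤ τ by linarith [hv.1]), hFτ, zero_div]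
  refine ⟨B⁻¹ * (M * (2 ^ q / q)), (b - τ) / 2, by positivity, by linarith, fun x hx hxb => ?_⟩
  have hx0 : 0 < x - τ := sub_pos.2 hx
  -- Then x is interior to (τ, τ + T), and τ + T < b by the choice of δ.
  set T := 2 * (x - τ) with hT
  have hder : HasDerivAt (fun y => B * ∫ u in τ..y, g u) (B * g x) x :=
    (intervalIntegral.integral_hasDerivAt_right (hg.intervalIntegrable _ _)
      (hg.stronglyMeasurableAtFilter _ _) hg.continuousAt).const_mul B
  -- The Lipschitz bound for F, integrated against v^(q-1) over [0, T], bounds the increments of B ∫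
  -- g near x, hence its derivative B g(x).
  have hle := hder.le_of_lip' (C := M * (T ^ q / q)) (by positivity) (by
    filter_upwards [Ioo_mem_nhds hx (show x < τ + T by linarith)] with y hy
    obtain ⟨i1, e1⟩ := hext T y (by linarith) hy.1 hy.2.le (by linarith)
    obtain ⟨i2, e2⟩ := hext T x (by linarith) hx (by linarith) (by linarith)
    have hker := integral_inv_abs_rpow (q := 1 - q) (by linarith) (Y := T) (by linarith)
    rw [sub_sub_cancel] at hker
    rw [e1, e2, ← intervalIntegral.integral_sub i1 i2, ← hker, mul_right_comm,
      ← intervalIntegral.integral_const_mul]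
    refine intervalIntegral.norm_integral_le_of_norm_le (by linarith) (.of_forall fun v hv => ?_)
      ((intervalIntegrable_inv_abs_rpow (by linarith) _ _).const_mul _)
    rw [← sub_div, norm_div, Real.norm_of_nonneg (show 0 ≤ |v| ^ (1 - q) by positivity),
      div_eq_mul_inv]
    refine mul_le_mul_of_nonneg_right ?_ (by positivity)
    refine (hLip _ ⟨le_max_right _ _, max_lt (by linarith [hv.1, hy.2]) hb⟩ _
      ⟨le_max_right _ _, max_lt (by linarith [hv.1]) hb⟩).trans
      (mul_le_mul_of_nonneg_left ?_ hM0.le)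
    have := abs_max_sub_max_le_abs (y - v) (x - v) τ
    rwa [sub_sub_sub_cancel_right] at this)
  rw [norm_mul, Real.norm_of_nonneg hB0.le, Real.norm_eq_abs, hT,
    Real.mul_rpow zero_le_two hx0.le] at hle
  calc |f x - f τ| = B⁻¹ * (B * |g x|) := by rw [← mul_assoc, inv_mul_cancel₀ hB0.ne', one_mul]
    _ ≤ B⁻¹ * (M * (2 ^ q * (x - τ) ^ q / q)) := by gcongr
    _ = _ := by ring

/-! ### Reflection, restriction and gluing of one-sided derivatives. -/

/-- The sign in -g(-u) cancels the reversal of orientation, so derivatives change sign exactly once.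
-/
theorem rlIntegral_comp_neg (q a : ℝ) (g : ℝ → ℝ) (x : ℝ) :
    rlIntegral q (-a) (fun u => -g (-u)) x = rlIntegral q a g (-x) := by
  unfold rlIntegral
  congr 1
  have h := intervalIntegral.integral_comp_neg (fun u => -g u / |-x - u| ^ q) (a := -a) (b := x)
  rw [neg_neg, intervalIntegral.integral_symm a (-x)] at h
  simp only [neg_div, intervalIntegral.integral_neg, neg_neg] at h ⊢
  rw [← h]
  congr 1
  refine intervalIntegral.integral_congr fun u _ => ?_
  rw [← abs_neg (x - u)]
  congr 3
  ring

theorem HasRLDerivAt.comp_neg {q a D x : ℝ} {g : ℝ → ℝ} (h : HasRLDerivAt q a g D x) :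
    HasRLDerivAt q (-a) (fun u => -g (-u)) (-D) (-x) := by
  have hneg : Tendsto (fun z : ℝ => -z) (𝓝 (-x)) (𝓝 x) := continuous_neg.tendsto' _ _ (neg_neg x)
  refine ⟨?_, ?_⟩
  · filter_upwards [hneg.eventually h.1] with z hz
    have h1 := ((IntervalIntegrable.iff_comp_neg (by simp)).1 hz).neg
    rw [neg_neg] at h1
    refine h1.congr fun u _ => ?_
    simp only [Pi.neg_apply, neg_div]
    rw [← abs_neg (z - u)]
    congr 4
    ring
  · rw [funext (rlIntegral_comp_neg q a g)]
    have h2 : HasDerivAt (rlIntegral q a g) D (-(-x)) := (neg_neg x).symm ▸ h.2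
    simpa [Function.comp_def] using h2.comp (-x) (hasDerivAt_neg (-x))

theorem HasLFDWithin.comp_neg {q L y : ℝ} {f : ℝ → ℝ} {S : Set ℝ} (hodd : ∀ u, f (-u) = -f u)
    (h : HasLFDWithin q f S L y) : HasLFDWithin q f (Neg.neg ⁻¹' S) (-L) (-y) := by
  obtain ⟨D, hD, hlim⟩ := h
  have hneg : Tendsto (fun z : ℝ => -z) (𝓝[(Neg.neg ⁻¹' S) \ {-y}] (-y)) (𝓝[S \ {y}] y) := by
    refine tendsto_nhdsWithin_iff.2 ⟨(continuous_neg.tendsto' _ _ (neg_neg y)).mono_left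
      nhdsWithin_le_nhds, eventually_nhdsWithin_of_forall fun z hz => ⟨hz.1, fun h => hz.2 ?_⟩⟩
    rw [mem_singleton_iff] at h ⊢
    rw [← h, neg_neg]
  refine ⟨fun x => -D (-x), ?_, (hlim.comp hneg).neg⟩
  filter_upwards [hneg.eventually hD] with x hx
  have := hx.comp_neg
  rw [neg_neg] at this
  convert this using 2 with u
  rw [hodd, hodd]
  ring

theorem LFDExistsWithin.comp_neg {q y : ℝ} {f : ℝ → ℝ} {S : Set ℝ} (hodd : ∀ u, f (-u) = -f u)
    (h : LFDExistsWithin q f S y) : LFDExistsWithin q f (Neg.neg ⁻¹' S) (-y) :=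
  let ⟨L, hL⟩ := h
  ⟨-L, hL.comp_neg hodd⟩

theorem LFDExistsWithin.mono {q y : ℝ} {f : ℝ → ℝ} {S T : Set ℝ} (hST : S ⊆ T)
    (h : LFDExistsWithin q f T y) : LFDExistsWithin q f S y := by
  obtain ⟨L, D, hD, hlim⟩ := h
  have hle : 𝓝[S \ {y}] y ≤ 𝓝[T \ {y}] y := nhdsWithin_mono _ (sdiff_subset_sdiff_left hST)
  exact ⟨L, D, hD.filter_mono hle, hlim.mono_left hle⟩

theorem HasLFDWithin.univ_of_Ici_of_Iic {q L y : ℝ} {f : ℝ → ℝ}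
    (h1 : HasLFDWithin q f (Ici y) L y) (h2 : HasLFDWithin q f (Iic y) L y) :
    HasLFDWithin q f univ L y := by
  obtain ⟨D1, hD1, hl1⟩ := h1
  obtain ⟨D2, hD2, hl2⟩ := h2
  rw [Ici_sdiff_left] at hD1 hl1
  rw [Iic_sdiff_right] at hD2 hl2
  have e1 : (fun x => if y < x then D1 x else D2 x) =ᶠ[𝓝[>] y] D1 :=
    eventually_nhdsWithin_of_forall fun x hx => if_pos hx
  have e2 : (fun x => if y < x then D1 x else D2 x) =ᶠ[𝓝[<] y] D2 :=
    eventually_nhdsWithin_of_forall fun x hx => if_neg (not_lt.2 (le_of_lt hx))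
  refine ⟨fun x => if y < x then D1 x else D2 x, ?_, ?_⟩
  · rw [← compl_eq_univ_sdiff, ← Iio_union_Ioi, nhdsWithin_union, eventually_sup]
    constructor
    · filter_upwards [hD2, e2] with x hx he
      rwa [he]
    · filter_upwards [hD1, e1] with x hx he
      rwa [he]
  · rw [← compl_eq_univ_sdiff, ← Iio_union_Ioi, nhdsWithin_union]
    exact (hl2.congr' e2.symm).sup (hl1.congr' e1.symm)

/-! ### Box dimension of graphs from two-sided oscillation bounds. -/

section BoxDimension

open Metric

theorem isCover_iff_dist {X : Type*} [PseudoMetricSpace X] {ε : NNReal} {A C : Set X} :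
    IsCover ε A C ↔ ∀ x ∈ A, ∃ y ∈ C, dist x y ≤ ε := by
  refine forall₂_congr fun x _ => exists_congr fun y => and_congr_right fun _ => ?_
  change edist x y ≤ ε ↔ _
  rw [edist_nndist, ENNReal.coe_le_coe, ← NNReal.coe_le_coe, coe_nndist]

/-- The part of the graph of a function over `[a, b]` is covered by the squares centred on a
suitable grid, if the function oscillates by at most `m ε` over distances at most `ε`. -/
theorem externalCoveringNumber_graph_le {W : ℝ → ℝ} {a b : ℝ} {ε : NNReal} (hε : 0 < ε)
    {m n : ℕ} (hn : b - a ≤ n * ε)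
    (hm : ∀ t v : ℝ, |v| ≤ ε → |W (t + v) - W t| ≤ m * ε) :
    externalCoveringNumber ε ((fun t : ℝ => (t, W t)) '' Icc a b) ≤
      ((n + 1) * (2 * m + 1) : ℕ) := by
  have hε' : (0 : ℝ) < ε := hε
  -- In each column the centres are spaced by ε and reach m steps above and below the graph; these
  -- centres need not lie on the graph.
  let c : ℕ × ℕ → ℝ × ℝ := fun p => (a + p.1 * ε, W (a + p.1 * ε) + ((p.2 : ℝ) - m) * ε)
  let C : Finset (ℝ × ℝ) := (Finset.range (n + 1) ×ˢ Finset.range (2 * m + 1)).image c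
  have hcard : C.card ≤ (n + 1) * (2 * m + 1) :=
    Finset.card_image_le.trans (by simp)
  refine le_trans (IsCover.externalCoveringNumber_le_encard (C := (C : Set (ℝ × ℝ))) ?_) ?_
  · rw [isCover_iff_dist]
    rintro _ ⟨t, ht, rfl⟩
    have h0 : 0 ≤ (t - a) / ε := div_nonneg (sub_nonneg.2 ht.1) hε'.le
    set i := ⌊(t - a) / ε⌋₊ with hi
    have hi1 : (i : ℝ) * ε ≤ t - a := (le_div_iff₀ hε').1 (Nat.floor_le h0)
    have hi2 : t - a < (i + 1) * ε := (div_lt_iff₀ hε').1 (Nat.lt_floor_add_one _)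
    have hin : i ≤ n := by
      have : (i : ℝ) ≤ n := by
        refine (Nat.floor_le h0).trans ((div_le_iff₀ hε').2 ?_)
        linarith [ht.2]
      exact_mod_cast this
    have ht1 : |t - (a + i * ε)| ≤ ε := by
      rw [abs_le]
      constructor <;> linarith
    have hW := hm (a + i * ε) (t - (a + i * ε)) ht1
    rw [add_sub_cancel] at hW
    set d := W t - W (a + i * ε) with hd
    have hd' := abs_le.1 hW
    have h0' : 0 ≤ d / ε + m := by
      have : -(m : ℝ) ≤ d / ε := by rw [le_div_iff₀ hε']; linarith
      linarith
    set j := ⌊d / ε + m⌋₊ with hj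
    have hj1 : ((j : ℝ) - m) * ε ≤ d := by
      rw [← le_div_iff₀ hε']
      linarith [Nat.floor_le h0']
    have hj2 : d < ((j : ℝ) - m + 1) * ε := by
      rw [← div_lt_iff₀ hε']
      linarith [Nat.lt_floor_add_one (d / ε + m)]
    have hjm : j ≤ 2 * m := by
      have : (j : ℝ) ≤ 2 * m := by
        have h1 : d / ε ≤ m := by rw [div_le_iff₀ hε']; linarith
        linarith [Nat.floor_le h0']
      exact_mod_cast this
    refine ⟨c (i, j), ?_, ?_⟩
    · rw [Finset.mem_coe]
      exact Finset.mem_image_of_mem _ (Finset.mem_product.2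
        ⟨Finset.mem_range.2 (by omega), Finset.mem_range.2 (by omega)⟩)
    · rw [Prod.dist_eq, Real.dist_eq, Real.dist_eq]
      refine max_le ht1 ?_
      simp only [c]
      rw [abs_le]
      constructor <;> linarith
  · rw [encard_coe_eq_coe_finsetCard]
    exact_mod_cast hcard

theorem volume_iUnion_closedBall_le {C : Finset (ℝ × ℝ)} {ρ : ℝ} (hρ : 0 ≤ ρ) :
    volume (⋃ p ∈ C, closedBall p ρ) ≤ ENNReal.ofReal (C.card * (2 * ρ) ^ 2) := by
  refine (measure_biUnion_finset_le _ _).trans (le_of_eq ?_)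
  have : ∀ p : ℝ × ℝ, volume (closedBall p ρ) = ENNReal.ofReal ((2 * ρ) ^ 2) := fun p => by
    rw [← Prod.mk.eta (p := p), ← closedBall_prod_same, Measure.volume_eq_prod, Measure.prod_prod,
      Real.volume_closedBall, Real.volume_closedBall, ← ENNReal.ofReal_mul (by positivity), sq]
  simp only [this, Finset.sum_const, nsmul_eq_mul]
  rw [ENNReal.ofReal_mul (by positivity), ENNReal.ofReal_natCast]

/-- Lower bound for the number of squares that cover a graph, by comparison of areas. -/
theorem osc_mul_le_card_of_isCover_graph {W : ℝ → ℝ} (hW : Continuous W) {a b o : ℝ} {ε : NNReal}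
    (ho : 0 ≤ o)
    (hosc : ∀ t : ℝ, ∃ x ∈ Icc t (t + ε), ∃ y ∈ Icc t (t + ε), o ≤ |W x - W y|)
    {C : Finset (ℝ × ℝ)} (hC : IsCover ε ((fun t : ℝ => (t, W t)) '' Icc a b) (C : Set (ℝ × ℝ))) :
    o * (b - ε - a) ≤ C.card * (2 * (2 * ε)) ^ 2 := by
  rw [isCover_iff_dist] at hC
  have hε : (0 : ℝ) ≤ ε := ε.coe_nonneg
  set U : Set (ℝ × ℝ) := ⋃ p ∈ C, closedBall p (2 * ε) with hU
  have hUm : MeasurableSet U :=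
    Finset.measurableSet_biUnion _ fun p _ => isClosed_closedBall.measurableSet
  -- By the intermediate value theorem each height between W y and W x is attained within horizontal
  -- distance ε of t, so doubling the squares covers a vertical segment of length o. Fubini then
  -- bounds the area from below.
  have hsec : ∀ t ∈ Icc a (b - ε), ENNReal.ofReal o ≤ volume (Prod.mk t ⁻¹' U) := by
    intro t ht
    obtain ⟨x, hx, y, hy, hxy⟩ := hosc t
    have hsub : uIcc (W y) (W x) ⊆ Prod.mk t ⁻¹' U := by
      intro z hz
      obtain ⟨w, hw, rfl⟩ := intermediate_value_uIcc hW.continuousOn hz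
      have hw' : w ∈ Icc t (t + ε) := (uIcc_subset_Icc hy hx) hw
      obtain ⟨p, hp, hpd⟩ := hC _ ⟨w, ⟨by linarith [ht.1, hw'.1], by linarith [ht.2, hw'.2]⟩, rfl⟩
      refine mem_iUnion₂.2 ⟨p, hp, ?_⟩
      rw [mem_closedBall]
      have h1 : dist (t, W w) (w, W w) ≤ ε := by
        rw [Prod.dist_eq, Real.dist_eq, dist_self, abs_sub_comm]
        refine max_le ?_ hε
        rw [abs_of_nonneg (by linarith [hw'.1])]
        linarith [hw'.2]
      linarith [dist_triangle (t, W w) (w, W w) p]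
    calc ENNReal.ofReal o ≤ ENNReal.ofReal |W x - W y| := ENNReal.ofReal_le_ofReal hxy
      _ = volume (uIcc (W y) (W x)) := by rw [Real.volume_interval]
      _ ≤ _ := measure_mono hsub
  have hlow : ENNReal.ofReal (o * (b - ε - a)) ≤ volume U := by
    rw [Measure.volume_eq_prod, Measure.prod_apply hUm, ENNReal.ofReal_mul ho, ← Real.volume_Icc,
      ← setLIntegral_const]
    exact (setLIntegral_mono' measurableSet_Icc hsec).trans (setLIntegral_le_lintegral _ _)
  have := hlow.trans (volume_iUnion_closedBall_le (by positivity))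
  exact (ENNReal.ofReal_le_ofReal_iff (by positivity)).1 this

/-- The constants disappear because log k₁ and log k₂ are divided by -log ε → ∞. -/
theorem tendsto_log_div_neg_log_of_rpow_bounds {N : NNReal → ℝ} {d k₁ k₂ : ℝ} (h1 : 0 < k₁)
    (h2 : 0 < k₂)
    (hN : ∀ᶠ ε : NNReal in 𝓝[>] 0, k₁ * (ε : ℝ) ^ (-d) ≤ N ε ∧ N ε ≤ k₂ * (ε : ℝ) ^ (-d)) :
    Tendsto (fun ε : NNReal => Real.log (N ε) / -Real.log ε) (𝓝[>] 0) (𝓝 d) := by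
  have hcoe : Tendsto (fun ε : NNReal => (ε : ℝ)) (𝓝[>] 0) (𝓝[>] 0) :=
    tendsto_nhdsWithin_iff.2 ⟨(NNReal.continuous_coe.tendsto' 0 0 rfl).mono_left nhdsWithin_le_nhds,
      eventually_nhdsWithin_of_forall fun ε hε => NNReal.coe_pos.2 hε⟩
  have hl : Tendsto (fun ε : NNReal => -Real.log ε) (𝓝[>] 0) atTop :=
    tendsto_neg_atBot_atTop.comp (Real.tendsto_log_nhdsGT_zero.comp hcoe)
  have hlim : ∀ k : ℝ, Tendsto (fun ε : NNReal => Real.log k / -Real.log ε + d) (𝓝[>] 0) (𝓝 d) :=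
    fun k => by simpa using (hl.const_div_atTop (Real.log k)).add_const d
  have hval : ∀ (k : ℝ) (ε : NNReal), 0 < k → 0 < ε → 0 < -Real.log ε →
      Real.log (k * (ε : ℝ) ^ (-d)) / -Real.log ε = Real.log k / -Real.log ε + d :=
    fun k ε hk hε hlog => by
      have hε' : (0 : ℝ) < ε := hε
      rw [Real.log_mul hk.ne' (Real.rpow_pos_of_pos hε' _).ne', Real.log_rpow hε', add_div, neg_mul,
        ← mul_neg, mul_div_assoc, div_self hlog.ne', mul_one]
  refine tendsto_of_tendsto_of_tendsto_of_le_of_le' (hlim k₁) (hlim k₂) ?_ ?_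
  · filter_upwards [hN, self_mem_nhdsWithin, hl.eventually_gt_atTop 0] with ε h hε hlog
    rw [← hval k₁ ε h1 hε hlog]
    have : 0 < k₁ * (ε : ℝ) ^ (-d) := mul_pos h1 (Real.rpow_pos_of_pos hε _)
    exact div_le_div_of_nonneg_right (Real.log_le_log this h.1) hlog.le
  · filter_upwards [hN, self_mem_nhdsWithin, hl.eventually_gt_atTop 0] with ε h hε hlog
    rw [← hval k₂ ε h2 hε hlog]
    have : 0 < k₁ * (ε : ℝ) ^ (-d) := mul_pos h1 (Real.rpow_pos_of_pos hε _)
    exact div_le_div_of_nonneg_right (Real.log_le_log (this.trans_le h.1) h.2) hlog.le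

/-- The graph of a function whose oscillation over all intervals of length `h` is of exact order
`h ^ α` has box dimension `2 - α`. -/
theorem hasBoxDim_graph {W : ℝ → ℝ} (hW : Continuous W) {α C c h₀ a b : ℝ} (hα : α < 1)
    (hC : 0 < C) (hc : 0 < c) (hh₀ : 0 < h₀) (hab : a < b)
    (hup : ∀ h : ℝ, 0 < h → h ≤ 1 → ∀ t v : ℝ, |v| ≤ h → |W (t + v) - W t| ≤ C * h ^ α)
    (hlow : ∀ h : ℝ, 0 < h → h ≤ h₀ → ∀ t : ℝ,
      ∃ x ∈ Icc t (t + h), ∃ y ∈ Icc t (t + h), c * h ^ α ≤ |W x - W y|) :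
    HasBoxDim ((fun t : ℝ => (t, W t)) '' Icc a b) (2 - α) := by
  set A := (fun t : ℝ => (t, W t)) '' Icc a b with hA
  -- Moving the centres onto the graph costs a factor 2 in the radius.
  have hup' : ∀ ε : NNReal, 0 < ε → ε ≤ 1 →
      coveringNumber (2 * ε) A ≤ ((⌈(b - a) / ε⌉₊ + 1) * (2 * ⌈C * (ε : ℝ) ^ (α - 1)⌉₊ + 1) : ℕ) :=
    fun ε hε hε1 => by
      have hε' : (0 : ℝ) < ε := hε
      refine (coveringNumber_two_mul_le_externalCoveringNumber ε A).trans
        (externalCoveringNumber_graph_le hε ?_ fun t v hv => (hup ε hε hε1 t v hv).trans ?_)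
      · exact (div_le_iff₀ hε').1 (Nat.le_ceil _)
      · calc C * (ε : ℝ) ^ α = C * (ε : ℝ) ^ (α - 1) * ε := by
              rw [Real.rpow_sub_one hε'.ne', mul_assoc, div_mul_cancel₀ _ hε'.ne']
          _ ≤ _ := by gcongr; exact Nat.le_ceil _
  have hfin : ∀ ε : NNReal, 0 < ε → coveringNumber ε A ≠ ⊤ := fun ε hε => by
    have h1 : 0 < min (ε / 2) 1 := lt_min (half_pos hε) one_pos
    refine ne_top_of_le_ne_top (ENat.natCast_ne_top _)
      ((coveringNumber_anti ?_).trans (hup' _ h1 (min_le_right _ _)))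
    calc 2 * min (ε / 2) 1 ≤ 2 * (ε / 2) := by gcongr; exact min_le_left _ _
      _ = ε := mul_div_cancel₀ _ two_ne_zero
  refine ⟨(nonempty_Icc.2 hab.le).image _, hfin, ?_⟩
  have hba : 0 < b - a := sub_pos.2 hab
  -- In k₁, 16 comes from squares of side 4ε and (b - a) / 2 from ε < (b - a) / 2. In k₂, 2^(2 - α)
  -- comes from applying the upper bound at ε / 2.
  refine tendsto_log_div_neg_log_of_rpow_bounds (k₁ := c * ((b - a) / 2) / 16)
    (k₂ := (b - a + 2) * (2 * C + 3) * 2 ^ (2 - α)) (by positivity) (by positivity) ?_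
  have hsmall : ∀ e : ℝ, 0 < e → ∀ᶠ ε : NNReal in 𝓝[>] 0, (ε : ℝ) < e := fun e he =>
    ((NNReal.continuous_coe.tendsto' 0 0 rfl).mono_left nhdsWithin_le_nhds).eventually_lt_const he
  filter_upwards [self_mem_nhdsWithin, hsmall h₀ hh₀, hsmall _ (half_pos hba), hsmall 1 one_pos]
    with ε hε hεh hεb hε1
  have hε' : (0 : ℝ) < ε := hε
  constructor
  · obtain ⟨D, _, hDfin, hDcov, hDcard⟩ := exists_set_encard_eq_coveringNumber (hfin ε hε)
    obtain ⟨D, rfl⟩ := hDfin.exists_finset_coe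
    have h := osc_mul_le_card_of_isCover_graph hW (o := c * (ε : ℝ) ^ α) (by positivity)
      (hlow ε hε' hεh.le) hDcov
    rw [← hDcard, encard_coe_eq_coe_finsetCard, ENat.toNat_natCast]
    have e : (ε : ℝ) ^ (-(2 - α)) = (ε : ℝ) ^ α / (ε : ℝ) ^ 2 := by
      rw [neg_sub, Real.rpow_sub hε', Real.rpow_two]
    have h2 : c * (ε : ℝ) ^ α * ((b - a) / 2) ≤ D.card * (2 * (2 * (ε : ℝ))) ^ 2 :=
      le_trans (by gcongr; linarith) h
    rw [e, mul_div_assoc', div_le_iff₀ (by positivity)]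
    nlinarith
  · have hδ : 0 < ε / 2 := half_pos hε
    have hδ' : (0 : ℝ) < (ε / 2 : NNReal) := hδ
    have hδ1 : ε / 2 ≤ 1 := by
      rw [← NNReal.coe_le_coe]
      push_cast
      linarith
    have h := hup' (ε / 2) hδ hδ1
    rw [mul_div_cancel₀ _ two_ne_zero] at h
    have hnat := ENat.toNat_le_of_le_natCast h
    set δ : ℝ := ((ε / 2 : NNReal) : ℝ) with hδdef
    have hδ1' : δ ≤ 1 := hδ1
    have hδe : δ = (ε : ℝ) / 2 := by rw [hδdef]; push_cast; rfl
    have hpow : 1 ≤ δ ^ (α - 1) := Real.one_le_rpow_of_pos_of_le_one_of_nonpos hδ' hδ1' (by linarith)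
    have b1 : (⌈(b - a) / δ⌉₊ : ℝ) + 1 ≤ (b - a + 2) * δ⁻¹ := by
      have h1 := (Nat.ceil_lt_add_one (div_nonneg hba.le hδ'.le)).le
      have h2 : 1 ≤ δ⁻¹ := (one_le_inv₀ hδ').2 hδ1'
      rw [add_mul, ← div_eq_mul_inv]
      linarith
    have b2 : 2 * (⌈C * δ ^ (α - 1)⌉₊ : ℝ) + 1 ≤ (2 * C + 3) * δ ^ (α - 1) := by
      have h1 := (Nat.ceil_lt_add_one (show 0 ≤ C * δ ^ (α - 1) by positivity)).le
      linarith
    have hfinal : δ⁻¹ * δ ^ (α - 1) = 2 ^ (2 - α) * (ε : ℝ) ^ (-(2 - α)) := by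
      rw [← Real.rpow_neg_one, ← Real.rpow_add hδ', hδe, Real.div_rpow hε'.le zero_le_two,
        show -1 + (α - 1) = -(2 - α) by ring, Real.rpow_neg zero_le_two, div_inv_eq_mul, mul_comm]
    calc ((coveringNumber ε A).toNat : ℝ)
        ≤ ((⌈(b - a) / δ⌉₊ : ℝ) + 1) * (2 * (⌈C * δ ^ (α - 1)⌉₊ : ℝ) + 1) := by exact_mod_cast hnat
      _ ≤ ((b - a + 2) * δ⁻¹) * ((2 * C + 3) * δ ^ (α - 1)) := by gcongr
      _ = (b - a + 2) * (2 * C + 3) * (δ⁻¹ * δ ^ (α - 1)) := by ring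
      _ = _ := by rw [hfinal]; ring

end BoxDimension

/-! ### Non-existence for q > α, critical order and conclusion. -/

/-- If a function oscillates by at least `c * h ^ α` over the interval `[τ, τ + h]` for all small
`h`, then it has no local fractional derivative from the right at `τ` of order `q > α`. -/
theorem not_LFDExistsWithin_Ici_of_osc {f : ℝ → ℝ} (hf : Continuous f) {A : ℝ}
    (hA : ∀ x, |f x| ≤ A) {q α τ c h₀ : ℝ} (hq0 : 0 < q) (hq : q < 1) (hαq : α < q) (hc : 0 < c)
    (hh₀ : 0 < h₀)
    (hosc : ∀ h : ℝ, 0 < h → h ≤ h₀ →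
      ∃ x ∈ Icc τ (τ + h), ∃ y ∈ Icc τ (τ + h), c * h ^ α ≤ |f x - f y|) :
    ¬ LFDExistsWithin q f (Ici τ) τ := fun hex => by
  obtain ⟨K, δ, hK, hδ, hle⟩ := exists_abs_sub_le_of_LFDExistsWithin_Ici hf hA hq0 hq hex
  have hlim : Tendsto (fun h : ℝ => 2 * K * h ^ (q - α)) (𝓝[>] 0) (𝓝 0) := by
    have hcont : Continuous fun h : ℝ => 2 * K * h ^ (q - α) :=
      continuous_const.mul (continuous_id.rpow_const fun _ => .inr (sub_pos.2 hαq).le)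
    have := (hcont.tendsto 0).mono_left (nhdsWithin_le_nhds (s := Ioi 0))
    simpa [Real.zero_rpow (sub_pos.2 hαq).ne'] using this
  obtain ⟨h, hlt, h0, hh⟩ := ((hlim.eventually_lt_const hc).and
    (Ioo_mem_nhdsGT (lt_min hh₀ hδ))).exists
  obtain ⟨x, hx, y, hy, hxy⟩ := hosc h h0 (hh.le.trans (min_le_left _ _))
  have hb : ∀ z ∈ Icc τ (τ + h), |f z - f τ| ≤ K * h ^ q := fun z hz => by
    rcases eq_or_lt_of_le hz.1 with rfl | hz1
    · rw [sub_self, abs_zero]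
      positivity
    · refine (hle z hz1 (hz.2.trans_lt (by linarith [min_le_right h₀ δ]))).trans ?_
      gcongr
      linarith [hz.2]
  have h1 : |f x - f y| ≤ 2 * K * h ^ q := by
    have := abs_sub_le (f x) (f τ) (f y)
    rw [abs_sub_comm (f τ)] at this
    linarith [hb x hx, hb y hy]
  have h2 : 2 * K * h ^ q = 2 * K * h ^ (q - α) * h ^ α := by
    rw [mul_assoc (2 * K), ← Real.rpow_add h0, sub_add_cancel]
  have hpos : 0 < h ^ α := Real.rpow_pos_of_pos h0 _
  have := mul_lt_mul_of_pos_right hlt hpos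
  linarith

/-- The supremum is attained at α, since only orders strictly below q are tested; existence at α
itself plays no role. -/
theorem criticalOrderWithin_eq {f : ℝ → ℝ} {S : Set ℝ} {y α : ℝ} (hα0 : 0 < α) (hα1 : α < 1)
    (h1 : ∀ q, 0 < q → q < α → LFDExistsWithin q f S y)
    (h2 : ∀ q, α < q → q < 1 → ¬ LFDExistsWithin q f S y) : criticalOrderWithin f S y = α := by
  refine IsGreatest.csSup_eq ⟨⟨⟨hα0.le, hα1.le⟩, fun p hp => h1 p hp.1 hp.2⟩, fun q hq => ?_⟩
  by_contra! hlt
  obtain ⟨p, hp1, hp2⟩ := exists_between hlt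
  exact h2 p hp1 (hp2.trans_le hq.1.2) (hq.2 p ⟨hα0.trans hp1, hp2⟩)

theorem mainTheorem1 (lam s : ℝ) (hlam : 1 < lam) (hs1 : 1 < s) (hs2 : s < 2) :
    (∀ τ : ℝ, ∀ S ∈ ({univ, Ici τ, Iic τ} : Set (Set ℝ)),
      (∀ q : ℝ, 0 < q → q < 2 - s → HasLFDWithin q (weierstrass lam s) S 0 τ) ∧
      (∀ q : ℝ, 2 - s < q → q < 1 → ¬ LFDExistsWithin q (weierstrass lam s) S τ) ∧
      criticalOrderWithin (weierstrass lam s) S τ = 2 - s) ∧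
    (∀ a b : ℝ, a < b →
      HasBoxDim ((fun t : ℝ => (t, weierstrass lam s t)) '' Icc a b) s) := by
  have hlam0 : 0 < lam := by linarith
  rw [weierstrass_eq_lacunary s hlam0]
  obtain ⟨r, hr⟩ : ∃ r, r = lam ^ (s - 2) := ⟨_, rfl⟩
  rw [← hr]
  have hα0 : 0 < 2 - s := by linarith
  have hα1 : 2 - s < 1 := by linarith
  have hr' : r = lam ^ (-(2 - s)) := by rw [hr, neg_sub]
  have hr0 : 0 < r := hr ▸ Real.rpow_pos_of_pos hlam0 _
  have hr1 : r < 1 := hr ▸ Real.rpow_lt_one_of_one_lt_of_neg hlam (by linarith)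
  have hrlam : 1 < r * lam := by
    rw [hr, ← Real.rpow_add_one hlam0.ne']
    exact Real.one_lt_rpow hlam (by linarith)
  have hcont := continuous_lacunary hr0.le hr1 lam
  obtain ⟨h₀, c, hh₀, hc, hosc⟩ := exists_lacunary_osc hr1 hlam hrlam hr' hα0
  obtain ⟨C, hC, hhol⟩ := exists_abs_lacunary_sub_le hr1 hlam hrlam hr' hα0
  have hbd : ∀ x, |lacunary r lam x| ≤ ∑' j : ℕ, r ^ (j + 1) := fun x =>
    tsum_of_norm_bounded (summable_pow_succ hr0.le hr1).hasSum (norm_lacunary_term_le hr0.le lam x)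
  have hright : ∀ τ q : ℝ, 0 < q → q < 2 - s → HasLFDWithin q (lacunary r lam) (Ici τ) 0 τ :=
    fun τ q hq0 hq => hasLFDWithin_lacunary_Ici hr0 hr1 hlam0 hq0 (hq.trans hα1) (by
      rw [hr, ← Real.rpow_add hlam0]
      exact Real.rpow_lt_one_of_one_lt_of_neg hlam (by linarith)) τ
  have hleft : ∀ τ q : ℝ, 0 < q → q < 2 - s → HasLFDWithin q (lacunary r lam) (Iic τ) 0 τ :=
    fun τ q hq0 hq => by
      simpa using (hright (-τ) q hq0 hq).comp_neg (lacunary_neg r lam)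
  have hnright : ∀ τ q : ℝ, 2 - s < q → q < 1 → ¬ LFDExistsWithin q (lacunary r lam) (Ici τ) τ :=
    fun τ q hq hq1 => not_LFDExistsWithin_Ici_of_osc hcont hbd (hα0.trans hq) hq1 hq hc hh₀
      fun h h0 hh => hosc h h0 hh τ
  have key : ∀ τ : ℝ, ∀ S ∈ ({univ, Ici τ, Iic τ} : Set (Set ℝ)),
      (∀ q : ℝ, 0 < q → q < 2 - s → HasLFDWithin q (lacunary r lam) S 0 τ) ∧
      (∀ q : ℝ, 2 - s < q → q < 1 → ¬ LFDExistsWithin q (lacunary r lam) S τ) := by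
    rintro τ S (rfl | rfl | rfl)
    · exact ⟨fun q hq0 hq => (hright τ q hq0 hq).univ_of_Ici_of_Iic (hleft τ q hq0 hq),
        fun q hq hq1 hex => hnright τ q hq hq1 (hex.mono (subset_univ _))⟩
    · exact ⟨hright τ, hnright τ⟩
    · exact ⟨hleft τ, fun q hq hq1 hex => hnright (-τ) q hq hq1 (by
        simpa using hex.comp_neg (lacunary_neg r lam))⟩
  refine ⟨fun τ S hS => ⟨(key τ S hS).1, (key τ S hS).2, ?_⟩, fun a b hab => ?_⟩
  · exact criticalOrderWithin_eq hα0 hα1 (fun q hq0 hq => ⟨0, (key τ S hS).1 q hq0 hq⟩)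
      (key τ S hS).2
  · simpa using hasBoxDim_graph hcont hα1 hC hc hh₀ hab hhol hosc
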